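/- All manifolds are smooth, Hausdorff, second countable, connected and without boundary; all bundles, sections and maps are smooth. Let $M$ be an oriented four-manifold with a fixed Lorentzian metric $g$ (signature $(3,1)$), with Hodge operator $\ast_g$. Let $\Sigma=(\mathcal M,\mathcal G,\Phi)$ be a scalar structure: a finite-dimensional Riemannian manifold $(\mathcal M,\mathcal G)$ with a function $\Phi\in C^\infty(\mathcal M,\mathbb R)$. Let $\Xi=(\mathcal S,D,J,\omega)$ be an electromagnetic structure on $\mathcal M$: a finite-rank real vector bundle $\mathcal S$ with a symplectic pairing $\omega$, a flat connection $D$ compatible with $\omega$, and a taming $J$, that is, $J\in\Gamma(\mathrm{End}(\mathcal S))$ with $J^2=-1$, $\omega(J\cdot,J\cdot)=\omega$ and $Q:=\omega(J\cdot,\cdot)$ positive definite. Put $\mathcal D=(\Sigma,\Xi)$, $\Delta=(\mathcal S,D,\omega)$, $\mathcal D_0=(\Sigma,\Delta)$, and let $\Theta_\Xi=D\circ J-J\circ D\in\Omega^1(\mathcal M,\mathrm{End}(\mathcal S))$ and $\Psi_{\mathcal D}=(\sharp_{\mathcal G}\otimes\mathrm{id})(\Theta_\Xi)\in\Gamma(\mathcal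 M,T\mathcal M\otimes \mathrm{End}(\mathcal S))$. The set $\mathrm{Sol}^g_{\mathcal D}(M)$ of global scalar-electromagnetic solutions of type $\mathcal D$ consists of all pairs $(\varphi,\mathcal V)$ of a smooth map $\varphi:M\to\mathcal M$ and a two-form $\mathcal V\in\Omega^2(M,\mathcal S^\varphi)$ with values in the pulled-back bundle $\mathcal S^\varphi=\varphi^*\mathcal S$ such that 1. $\mathcal V$ is positively polarized: $(\ast_g\otimes J^\varphi)\mathcal V=\mathcal V$; 2. the scalar equations hold: $\mathrm{Tr}_g\nabla d\varphi-(\mathrm{grad}_{\mathcal G}\Phi)\circ\varphi-\tfrac12(\ast_g\mathcal V,\Psi_{\mathcal D}^\varphi\mathcal V)=0$, where $\nabla$ is induced by the Levi-Civita connections of $g$ and $\mathcal G$, and $(\cdot,\cdot)$ is the scalar product induced by $g$ and $Q^\varphi$ on $\wedge^2T^*M\otimes\mathcal S^\varphi$, extended trivially to a $(T\mathcal M)^\varphi$-valued pairing; 3. the twisted electromagnetic equations hold: $d_{D^\varphi}\mathcal V=0$, where $D^\varphi$ is the pulled-back connection. A scalar-electromagnetic duality $f\in\mathrm{Aut}(\mathcal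 D_0)$ is an automorphism $f$ of the vector bundle $\mathcal S$, covering a diffeomorphism $f_0$ of $\mathcal M$, which preserves $\omega$, is covariantly constant with respect to $D$ (that is, $D_{df_0(v)}(f\circ s\circ f_0^{-1})=f(D_vs)$ for all sections $s$ and tangent vectors $v$), and for which $f_0$ is an isometry of $(\mathcal M,\mathcal G)$ with $\Phi\circ f_0=\Phi$. It acts on pairs $(\varphi,\mathcal V)$ by $f\diamond(\varphi,\mathcal V)=(f_0\circ\varphi,\hat f^\varphi(\mathcal V))$, where $\hat f:\mathcal S\to f_0^*\mathcal S$ is the based isomorphism induced by $f$. Let $\mathcal D_f=(\Sigma,\Xi_f)$ with $\Xi_f=(\mathcal S,D,\mathbf{Ad}(f)(J),\omega)$, $\mathbf{Ad}(f)(J)=f\circ J\circ f^{-1}$; this is again an electromagnetic structure. Theorem. For every $f\in\mathrm{Aut}(\mathcal D_0)$, the map $(\varphi,\mathcal V)\mapsto f\diamond(\varphi,\mathcal V)$ restricts to a bijection from $\mathrm{Sol}^g_{\mathcal D}(M)$ onto $\mathrm{Sol}^g_{\mathcal D_f}(M)$; in particular $f\diamond\mathrm{Sol}^g_{\mathcal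 D}(M)=\mathrm{Sol}^g_{\mathcal D_f}(M)$. -/

import Mathlib

open Bundle Module Set
open scoped Manifold ContDiff Topology

noncomputable section


namespace ESM

/-! ### Preliminaries on tangent spaces -/

section Tangent

variable {d : ℕ} {N : Type*} [TopologicalSpace N] [ChartedSpace (EuclideanSpace ℝ (Fin d)) N]

instance instFiniteDimensionalTangent (x : N) : FiniteDimensional ℝ (TangentSpace (𝓡 d) x) :=
  inferInstanceAs (FiniteDimensional ℝ (EuclideanSpace ℝ (Fin d)))

instance instT2Tangent (x : N) : T2Space (TangentSpace (𝓡 d) x) :=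
  inferInstanceAs (T2Space (EuclideanSpace ℝ (Fin d)))

/-- A basis of the tangent space (the one given by the standard basis of the model space). All
constructions below that use it, such as metric contractions, are independent of this choice. -/
def tangentBasis (x : N) : Basis (Fin d) ℝ (TangentSpace (𝓡 d) x) :=
  (EuclideanSpace.basisFun (Fin d) ℝ).toBasis

theorem finrank_tangent (x : N) : finrank ℝ (TangentSpace (𝓡 d) x) = d :=
  (finrank_eq_card_basis (tangentBasis x)).trans (Fintype.card_fin d)

variable [IsManifold (𝓡 d) ∞ N]

/-- A vector field is smooth. -/
def SmoothVectorField (X : Π x : N, TangentSpace (𝓡 d) x) : Prop :=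
  ContMDiff (𝓡 d) ((𝓡 d).prod 𝓘(ℝ, EuclideanSpace ℝ (Fin d))) ∞
    (fun x ↦ TotalSpace.mk' (EuclideanSpace ℝ (Fin d)) x (X x))

/-! ### Musical isomorphisms and the Levi-Civita connection of a (pseudo-)Riemannian metric

Here `G x` is the bilinear form of the metric on the tangent space at `x`. -/

/-- The value of the metric, as a field of bilinear forms on tangent spaces. -/
abbrev MetricField (d : ℕ) (N : Type*) [TopologicalSpace N]
    [ChartedSpace (EuclideanSpace ℝ (Fin d)) N] :=
  Π x : N, TangentSpace (𝓡 d) x →L[ℝ] TangentSpace (𝓡 d) x →L[ℝ] ℝ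

/-- The musical isomorphism `♯ : T*N → TN`, i.e. the inverse of `v ↦ G(v, ·)`. -/
def sharp (G : MetricField d N) (x : N) :
    (TangentSpace (𝓡 d) x →L[ℝ] ℝ) →L[ℝ] TangentSpace (𝓡 d) x :=
  (G x).inverse

/-- The coefficients `G^{ij}` of the inverse metric in the basis `tangentBasis x`. -/
def invMetric (G : MetricField d N) (x : N) (i j : Fin d) : ℝ :=
  (tangentBasis x).coord j (sharp G x ((tangentBasis x).coord i).toContinuousLinearMap)

/-- The trace with respect to `G` of a bilinear map on the tangent space at `x`. -/
def metricTrace (G : MetricField d N) (x : N) {W : Type*} [AddCommGroup W] [Module ℝ W]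
    (B : TangentSpace (𝓡 d) x → TangentSpace (𝓡 d) x → W) : W :=
  ∑ i, ∑ j, invMetric G x i j • B (tangentBasis x i) (tangentBasis x j)

/-- The right hand side of the Koszul formula for `2 G(∇_X Y, Z)`. -/
def koszul (G : MetricField d N) (X Y Z : Π x : N, TangentSpace (𝓡 d) x) (x : N) : ℝ :=
  mvfderiv (𝓡 d) (fun y ↦ G y (Y y) (Z y)) x (X x)
  + mvfderiv (𝓡 d) (fun y ↦ G y (X y) (Z y)) x (Y x)
  - mvfderiv (𝓡 d) (fun y ↦ G y (X y) (Y y)) x (Z x)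
  + G x (VectorField.mlieBracket (𝓡 d) X Y x) (Z x)
  - G x (VectorField.mlieBracket (𝓡 d) X Z x) (Y x)
  - G x (VectorField.mlieBracket (𝓡 d) Y Z x) (X x)

/-- The Levi-Civita connection of `G`: `leviCivita G Y x v` is `(∇_v Y)(x)`, the vector whose
`G`-product with `w` is half the Koszul expression. Tangent vectors at `x` are
extended to vector fields that are smooth near `x`; for `Y` differentiable at `x` the Koszul
expression does not depend on the extensions. -/
def leviCivita (G : MetricField d N) (Y : Π x : N, TangentSpace (𝓡 d) x) (x : N)
    (v : TangentSpace (𝓡 d) x) : TangentSpace (𝓡 d) x :=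
  sharp G x (LinearMap.toContinuousLinearMap ((tangentBasis x).constr ℝ fun a ↦
    (1 / 2 : ℝ) * koszul G (FiberBundle.extend (EuclideanSpace ℝ (Fin d)) v) Y
      (FiberBundle.extend (EuclideanSpace ℝ (Fin d)) (tangentBasis x a)) x))

end Tangent

/-! ### Pulled-back connections -/

section Pullback

variable {m d : ℕ} {M : Type*} [TopologicalSpace M] [ChartedSpace (EuclideanSpace ℝ (Fin m)) M]
  {N : Type*} [TopologicalSpace N] [ChartedSpace (EuclideanSpace ℝ (Fin d)) N]
  (F : Type*) [NormedAddCommGroup F] [NormedSpace ℝ F] [FiniteDimensional ℝ F]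
  {S : N → Type*} [TopologicalSpace (TotalSpace F S)]
  [∀ y, AddCommGroup (S y)] [∀ y, Module ℝ (S y)] [∀ y, TopologicalSpace (S y)]
  [FiberBundle F S] [VectorBundle ℝ F S] [ContMDiffVectorBundle 1 F S (𝓡 d)]

/-- The pull-back `cov^φ` through `φ : M → N` of a connection `cov` on a vector bundle `S` over
`N`. Write a section `σ` of `φ^* S` near `x` as `σ = ∑ σⁱ (eᵢ ∘ φ)`, where `e` is a local
frame of `S` near `φ x`. Then `cov^φ_v σ = ∑ dσⁱ(v) eᵢ(φ x) + σⁱ(x) cov_{dφ(v)} eᵢ`. -/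
def pullbackCov (cov : (Π y : N, S y) → Π y : N, TangentSpace (𝓡 d) y → S y) (φ : M → N)
    (σ : Π x : M, S (φ x)) (x : M) (v : TangentSpace (𝓡 m) x) : S (φ x) :=
  let e := trivializationAt F S (φ x)
  let b := finBasis ℝ F
  ∑ i, (mvfderiv (𝓡 m) (fun x' ↦ e.localFrameCoeff (𝓡 d) b i (φ x') (σ x')) x v •
      e.localFrame b i (φ x)
    + e.localFrameCoeff (𝓡 d) b i (φ x) (σ x) •
      cov (e.localFrame b i) (φ x) (mfderiv (𝓡 m) (𝓡 d) φ x v))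

end Pullback

/-! ### Scalar structures and the modified tension field -/

/-- A scalar structure with scalar manifold `𝓜`: a smooth Riemannian metric and a smooth
potential. -/
structure ScalarStructure (d : ℕ) (𝓜 : Type*) [TopologicalSpace 𝓜]
    [ChartedSpace (EuclideanSpace ℝ (Fin d)) 𝓜] [IsManifold (𝓡 d) ∞ 𝓜] where
  metric : ContMDiffRiemannianMetric (𝓡 d) ∞ (EuclideanSpace ℝ (Fin d))
    (fun y : 𝓜 ↦ TangentSpace (𝓡 d) y)
  potential : 𝓜 → ℝ
  smooth_potential : ContMDiff (𝓡 d) 𝓘(ℝ) ∞ potential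

/-- A Lorentzian metric on a four-manifold: a smooth field of symmetric bilinear forms of
signature `(3,1)` (three positive, one negative). -/
structure LorentzianMetric (M : Type*) [TopologicalSpace M]
    [ChartedSpace (EuclideanSpace ℝ (Fin 4)) M] [IsManifold (𝓡 4) ∞ M] where
  inner : MetricField 4 M
  symm (x : M) (v w : TangentSpace (𝓡 4) x) : inner x v w = inner x w v
  signature (x : M) : ∃ b : Basis (Fin 4) ℝ (TangentSpace (𝓡 4) x),
    ∀ i j, inner x (b i) (b j) = if i = j then (if i = 0 then -1 else 1) else 0
  contMDiff : ContMDiff (𝓡 4) ((𝓡 4).prod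
      𝓘(ℝ, EuclideanSpace ℝ (Fin 4) →L[ℝ] EuclideanSpace ℝ (Fin 4) →L[ℝ] ℝ)) ∞
    (fun x ↦ TotalSpace.mk' (EuclideanSpace ℝ (Fin 4) →L[ℝ] EuclideanSpace ℝ (Fin 4) →L[ℝ] ℝ)
      (E := fun x : M ↦ TangentSpace (𝓡 4) x →L[ℝ] TangentSpace (𝓡 4) x →L[ℝ] ℝ)
      x (inner x))

/-- An orientation of a four-manifold: an orientation of each tangent space, such that around each
point there is a smooth local frame of the tangent bundle which is positively oriented. -/
structure ManifoldOrientation (M : Type*) [TopologicalSpace M]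
    [ChartedSpace (EuclideanSpace ℝ (Fin 4)) M] [IsManifold (𝓡 4) ∞ M] where
  at' (x : M) : Orientation ℝ (TangentSpace (𝓡 4) x) (Fin 4)
  locally_const (x : M) : ∃ (u : Set M) (s : Fin 4 → Π y : M, TangentSpace (𝓡 4) y)
    (hs : IsLocalFrameOn (𝓡 4) (EuclideanSpace ℝ (Fin 4)) ∞ s u),
    IsOpen u ∧ x ∈ u ∧ ∀ (y : M) (hy : y ∈ u), (hs.toBasisAt hy).orientation = at' y

section Scalar

variable {M : Type*} [TopologicalSpace M] [ChartedSpace (EuclideanSpace ℝ (Fin 4)) M]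
  [IsManifold (𝓡 4) ∞ M]
  {d : ℕ} {𝓜 : Type*} [TopologicalSpace 𝓜] [ChartedSpace (EuclideanSpace ℝ (Fin d)) 𝓜]
  [IsManifold (𝓡 d) ∞ 𝓜]

/-- The second fundamental form `(∇ dφ)(u, v) = ∇^φ_u (dφ(V)) - dφ(∇_u V)`, where `V` is a local
extension of `v`. -/
def secondFundamentalForm (g : MetricField 4 M) (G : MetricField d 𝓜) (φ : M → 𝓜) (x : M)
    (u v : TangentSpace (𝓡 4) x) : TangentSpace (𝓡 d) (φ x) :=
  pullbackCov (EuclideanSpace ℝ (Fin d)) (leviCivita G) φ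
    (fun x' ↦ mfderiv (𝓡 4) (𝓡 d) φ x'
      (FiberBundle.extend (EuclideanSpace ℝ (Fin 4)) v x')) x u
  - mfderiv (𝓡 4) (𝓡 d) φ x
      (leviCivita g (FiberBundle.extend (EuclideanSpace ℝ (Fin 4)) v) x u)

/-- The tension field `Tr_g (∇ dφ)`, a section of `φ^* T𝓜`. -/
def tensionField (g : MetricField 4 M) (G : MetricField d 𝓜) (φ : M → 𝓜) (x : M) :
    TangentSpace (𝓡 d) (φ x) :=
  metricTrace g x (secondFundamentalForm g G φ x)

/-- The gradient of a function. -/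
def gradient (G : MetricField d 𝓜) (Φ : 𝓜 → ℝ) (y : 𝓜) : TangentSpace (𝓡 d) y :=
  sharp G y (mvfderiv (𝓡 d) Φ y)

/-- The modified tension field. -/
def modifiedTension (Sig : ScalarStructure d 𝓜) (g : LorentzianMetric M) (φ : M → 𝓜) (x : M) :
    TangentSpace (𝓡 d) (φ x) :=
  tensionField g.inner Sig.metric.inner φ x - gradient Sig.metric.inner Sig.potential (φ x)

/-! ### The Hodge operator on two-forms with values in a vector space -/

/-- The volume form of an oriented Lorentzian four-manifold at `x`. -/
def volumeForm (o : ManifoldOrientation M) (g : LorentzianMetric M) (x : M) :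
    TangentSpace (𝓡 4) x [⋀^Fin 4]→ₗ[ℝ] ℝ :=
  let b : Basis (Fin 4) ℝ (TangentSpace (𝓡 4) x) := (o.at' x).someBasis
    ((Fintype.card_fin 4).trans (finrank_tangent (d := 4) x).symm)
  Real.sqrt |(Matrix.of fun i j ↦ g.inner x (b i) (b j)).det| • b.det

/-- The Hodge operator `*_g ⊗ id_W` on `W`-valued two-forms at `x`:
`(* ρ)(u, v) = ½ g^{ik} g^{jl} ρ_{ij} vol(e_k, e_l, u, v)`. -/
def hodgeStar (o : ManifoldOrientation M) (g : LorentzianMetric M) (x : M) {W : Type*}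
    [AddCommGroup W] [Module ℝ W] (ρ : TangentSpace (𝓡 4) x [⋀^Fin 2]→ₗ[ℝ] W) :
    TangentSpace (𝓡 4) x [⋀^Fin 2]→ₗ[ℝ] W :=
  let e := tangentBasis x
  (1 / 2 : ℝ) • ∑ i, ∑ j, ∑ k, ∑ l, (invMetric g.inner x i k * invMetric g.inner x j l) •
    (LinearMap.toSpanSingleton ℝ W (ρ ![e i, e j])).compAlternatingMap
      (((volumeForm o g x).curryLeft (e k)).curryLeft (e l))

/-- The scalar product induced by `g` and a bilinear form `Q` on `W` on the space of `W`-valued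
two-forms at `x`: `(α, β) = ½ g^{ik} g^{jl} Q(α_{ij}, β_{kl})`. -/
def formInner (g : LorentzianMetric M) (x : M) {W : Type*} [AddCommGroup W] [Module ℝ W]
    (Q : W →ₗ[ℝ] W →ₗ[ℝ] ℝ) (α β : TangentSpace (𝓡 4) x [⋀^Fin 2]→ₗ[ℝ] W) : ℝ :=
  let e := tangentBasis x
  (1 / 2 : ℝ) * ∑ i, ∑ j, ∑ k, ∑ l, (invMetric g.inner x i k * invMetric g.inner x j l) *
    Q (α ![e i, e j]) (β ![e k, e l])

/-- The scalar product of two-forms, extended trivially to a `T`-valued pairing between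
`W`-valued two-forms `α` and elements `Ψ β` of `T ⊗ ⋀² ⊗ W`, where `Ψ ∈ T ⊗ End(W)`;
thus `(α, (w ⊗ A) β) = (α, A β) w`. -/
def extendedFormInner (g : LorentzianMetric M) (x : M) {W T : Type*} [AddCommGroup W] [Module ℝ W]
    [AddCommGroup T] [Module ℝ T] (Q : W →ₗ[ℝ] W →ₗ[ℝ] ℝ)
    (α : TangentSpace (𝓡 4) x [⋀^Fin 2]→ₗ[ℝ] W) (Ψ : TensorProduct ℝ T (Module.End ℝ W))
    (β : TangentSpace (𝓡 4) x [⋀^Fin 2]→ₗ[ℝ] W) : T :=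
  TensorProduct.lift
    (LinearMap.mk₂ ℝ (fun (w : T) (A : Module.End ℝ W) ↦
        formInner g x Q α (A.compAlternatingMap β) • w)
      (fun w w' A ↦ smul_add _ w w')
      (fun c w A ↦ smul_comm _ c w)
      (fun w A A' ↦ by
        rw [← add_smul]; congr 1
        simp only [formInner, LinearMap.compAlternatingMap_apply, LinearMap.add_apply, map_add,
          mul_add, Finset.sum_add_distrib])
      (fun c w A ↦ by
        rw [smul_smul]; congr 1
        simp only [formInner, LinearMap.compAlternatingMap_apply, LinearMap.smul_apply, map_smul,
          smul_eq_mul, Finset.mul_sum]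
        refine Finset.sum_congr rfl fun i _ ↦ Finset.sum_congr rfl fun j _ ↦
          Finset.sum_congr rfl fun k _ ↦ Finset.sum_congr rfl fun l _ ↦ ?_
        ring)) Ψ

end Scalar

/-! ### Duality structures and electromagnetic structures -/

section Duality

variable (d : ℕ) {𝓜 : Type*} [TopologicalSpace 𝓜] [ChartedSpace (EuclideanSpace ℝ (Fin d)) 𝓜]
  [IsManifold (𝓡 d) ∞ 𝓜]
  (F : Type*) [NormedAddCommGroup F] [NormedSpace ℝ F] [FiniteDimensional ℝ F]
  (S : 𝓜 → Type*) [TopologicalSpace (TotalSpace F S)]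
  [∀ y, AddCommGroup (S y)] [∀ y, Module ℝ (S y)] [∀ y, TopologicalSpace (S y)]
  [∀ y, IsTopologicalAddGroup (S y)] [∀ y, ContinuousSMul ℝ (S y)]
  [FiberBundle F S] [VectorBundle ℝ F S] [ContMDiffVectorBundle ∞ F S (𝓡 d)]

/-- A duality structure `(S, D, ω)` with underlying vector bundle `S`: a smooth symplectic pairing
`ω` and a smooth flat connection `D` compatible with `ω`. (The value
`D σ y v` is the covariant derivative of `σ` at `y` in the direction `v`.) -/
structure DualityStructure where
  pairing (y : 𝓜) : S y →L[ℝ] S y →L[ℝ] ℝ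
  pairing_alternating (y : 𝓜) (s : S y) : pairing y s s = 0
  pairing_nondegenerate (y : 𝓜) (s : S y) : (∀ t, pairing y s t = 0) → s = 0
  pairing_smooth : ContMDiff (𝓡 d) ((𝓡 d).prod 𝓘(ℝ, F →L[ℝ] F →L[ℝ] ℝ)) ∞
    (fun y ↦ TotalSpace.mk' (F →L[ℝ] F →L[ℝ] ℝ)
      (E := fun y : 𝓜 ↦ S y →L[ℝ] S y →L[ℝ] ℝ) y (pairing y))
  D : CovariantDerivative (𝓡 d) F S
  D_smooth : CovariantDerivative.ContMDiffCovariantDerivative D ∞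
  D_compatible (s t : Π y : 𝓜, S y) (y : 𝓜) (v : TangentSpace (𝓡 d) y) :
    MDifferentiableAt (𝓡 d) ((𝓡 d).prod 𝓘(ℝ, F)) (fun y' ↦ TotalSpace.mk' F y' (s y')) y →
    MDifferentiableAt (𝓡 d) ((𝓡 d).prod 𝓘(ℝ, F)) (fun y' ↦ TotalSpace.mk' F y' (t y')) y →
    mvfderiv (𝓡 d) (fun y' ↦ pairing y' (s y') (t y')) y v
      = pairing y (D s y v) (t y) + pairing y (s y) (D t y v)
  D_flat (X Y : Π y : 𝓜, TangentSpace (𝓡 d) y) (s : Π y : 𝓜, S y) :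
    SmoothVectorField X → SmoothVectorField Y →
    ContMDiff (𝓡 d) ((𝓡 d).prod 𝓘(ℝ, F)) ∞ (fun y ↦ TotalSpace.mk' F y (s y)) →
    ∀ y : 𝓜, D (fun y' ↦ D s y' (Y y')) y (X y) - D (fun y' ↦ D s y' (X y')) y (Y y)
      - D s y (VectorField.mlieBracket (𝓡 d) X Y y) = 0

/-- An electromagnetic structure `(S, D, J, ω)`: a duality structure with a taming `J`, i.e. a
smooth complex structure `J` on `S` which preserves `ω` and for which `Q(s,t) = ω(J s, t)` is
positive definite. -/
structure ElectromagneticStructure extends DualityStructure d F S where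
  J (y : 𝓜) : S y →L[ℝ] S y
  J_sq (y : 𝓜) (s : S y) : J y (J y s) = -s
  J_symplectic (y : 𝓜) (s t : S y) : pairing y (J y s) (J y t) = pairing y s t
  J_pos (y : 𝓜) (s : S y) : s ≠ 0 → 0 < pairing y (J y s) s
  J_smooth : ContMDiff ((𝓡 d).prod 𝓘(ℝ, F)) ((𝓡 d).prod 𝓘(ℝ, F)) ∞
    (fun p : TotalSpace F S ↦ TotalSpace.mk' F p.1 (J p.1 p.2))

/-- An unbased automorphism of the vector bundle `S`: a diffeomorphism `total` of the total
space which covers a diffeomorphism `base` of `𝓜` and restricts to linear isomorphisms `fiber y`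
between the fibers. -/
structure UnbasedAut where
  base : Diffeomorph (𝓡 d) (𝓡 d) 𝓜 𝓜 ∞
  total : Diffeomorph ((𝓡 d).prod 𝓘(ℝ, F)) ((𝓡 d).prod 𝓘(ℝ, F)) (TotalSpace F S)
    (TotalSpace F S) ∞
  fiber (y : 𝓜) : S y ≃L[ℝ] S (base y)
  total_apply (y : 𝓜) (s : S y) : total ⟨y, s⟩ = ⟨base y, fiber y s⟩

variable {d F S}

/-- The adjoint action `Ad(f)(A) = f ∘ A ∘ f⁻¹` of `f` on sections of `End(S)`. -/
def UnbasedAut.Ad (f : UnbasedAut d F S) (A : Π y : 𝓜, S y →L[ℝ] S y) (y : 𝓜) : S y →L[ℝ] S y :=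
  f.base.apply_symm_apply y ▸
    (((f.fiber (f.base.symm y)).toContinuousLinearMap.comp (A (f.base.symm y))).comp
      (f.fiber (f.base.symm y)).symm.toContinuousLinearMap)

theorem UnbasedAut.Ad_base (f : UnbasedAut d F S) (A : Π y : 𝓜, S y →L[ℝ] S y) (y : 𝓜)
    (s : S y) : f.Ad A (f.base y) (f.fiber y s) = f.fiber y (A y s) := by
  have key : ∀ (z : 𝓜) (h : f.base z = f.base y),
      (h ▸ (((f.fiber z).toContinuousLinearMap.comp (A z)).comp
        (f.fiber z).symm.toContinuousLinearMap) : S (f.base y) →L[ℝ] S (f.base y))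
        (f.fiber y s) = f.fiber y (A y s) := by
    intro z h
    obtain rfl : z = y := f.base.injective h
    simp
  exact key _ _

/-- `f` is a symmetry of the duality structure: it is symplectic and covariantly constant, that
is, the section `t = f ∘ s ∘ f₀⁻¹` satisfies `D_{df₀(v)} t = f (D_v s)` for every
section `s` (differentiable where the derivative is taken). -/
structure IsDualitySymmetry (Δ : DualityStructure d F S) (f : UnbasedAut d F S) : Prop where
  symplectic (y : 𝓜) (s t : S y) : Δ.pairing (f.base y) (f.fiber y s) (f.fiber y t) = Δ.pairing y s t
  parallel (s t : Π y : 𝓜, S y) (ht : ∀ y, t (f.base y) = f.fiber y (s y))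
    (y : 𝓜) (v : TangentSpace (𝓡 d) y) :
    MDifferentiableAt (𝓡 d) ((𝓡 d).prod 𝓘(ℝ, F)) (fun y' ↦ TotalSpace.mk' F y' (s y')) y →
    Δ.D t (f.base y) (mfderiv (𝓡 d) (𝓡 d) f.base y v) = f.fiber y (Δ.D s y v)

/-- A scalar-electromagnetic duality of `(Σ, Δ)`: a symmetry `f` of the duality structure `Δ`
whose projection `f₀` to `𝓜` is an isometry which preserves the scalar potential. -/
structure IsScalarElectromagneticDuality (Sig : ScalarStructure d 𝓜) (Δ : DualityStructure d F S)
    (f : UnbasedAut d F S) : Prop extends IsDualitySymmetry Δ f where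
  isometry (y : 𝓜) (v w : TangentSpace (𝓡 d) y) :
    Sig.metric.inner (f.base y) (mfderiv (𝓡 d) (𝓡 d) f.base y v) (mfderiv (𝓡 d) (𝓡 d) f.base y w)
      = Sig.metric.inner y v w
  potential (y : 𝓜) : Sig.potential (f.base y) = Sig.potential y

/-- The electromagnetic structure `Ξ_f = (S, D, Ad(f)(J), ω)`. -/
def ElectromagneticStructure.twist (Ξ : ElectromagneticStructure d F S) (f : UnbasedAut d F S)
    (hf : ∀ (y : 𝓜) (s t : S y), Ξ.pairing (f.base y) (f.fiber y s) (f.fiber y t) = Ξ.pairing y s t) :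
    ElectromagneticStructure d F S where
  toDualityStructure := Ξ.toDualityStructure
  J := f.Ad Ξ.J
  J_sq y s := by
    obtain ⟨y, rfl⟩ := (show Function.Surjective f.base from f.base.surjective) y
    obtain ⟨s, rfl⟩ := (show Function.Surjective (f.fiber y) from (f.fiber y).surjective) s
    rw [f.Ad_base, f.Ad_base, Ξ.J_sq, map_neg]
  J_symplectic y s t := by
    obtain ⟨y, rfl⟩ := (show Function.Surjective f.base from f.base.surjective) y
    obtain ⟨s, rfl⟩ := (show Function.Surjective (f.fiber y) from (f.fiber y).surjective) s
    obtain ⟨t, rfl⟩ := (show Function.Surjective (f.fiber y) from (f.fiber y).surjective) t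
    rw [f.Ad_base, f.Ad_base, hf, hf, Ξ.J_symplectic]
  J_pos y s hs := by
    obtain ⟨y, rfl⟩ := (show Function.Surjective f.base from f.base.surjective) y
    obtain ⟨s, rfl⟩ := (show Function.Surjective (f.fiber y) from (f.fiber y).surjective) s
    rw [f.Ad_base, hf]
    exact Ξ.J_pos y s fun h ↦ hs (by rw [h, map_zero])
  J_smooth := by
    refine (f.total.contMDiff.comp (Ξ.J_smooth.comp f.total.symm.contMDiff)).congr fun p ↦ ?_
    have key : ∀ q : TotalSpace F S, f.total q = p →
        TotalSpace.mk' F p.1 (f.Ad Ξ.J p.1 p.2) = f.total (TotalSpace.mk' F q.1 (Ξ.J q.1 q.2)) := by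
      rintro ⟨y, s⟩ h
      rw [f.total_apply] at h
      subst h
      exact (congrArg (TotalSpace.mk' F (f.base y)) (f.Ad_base Ξ.J y s)).trans
        (f.total_apply y (Ξ.J y s)).symm
    exact key _ (f.total.apply_symm_apply p)

/-! ### The fundamental form and the fundamental field -/

/-- The scalar product `Q(s, t) = ω(J s, t)` on the fibers of `S`. -/
def ElectromagneticStructure.Q (Ξ : ElectromagneticStructure d F S) (y : 𝓜) :
    S y →ₗ[ℝ] S y →ₗ[ℝ] ℝ :=
  LinearMap.mk₂ ℝ (fun s t ↦ Ξ.pairing y (Ξ.J y s) t) (by simp) (by simp) (by simp) (by simp)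

/-- The operator `D ∘ J - J ∘ D` on sections of `S`, at the point `y`. -/
def ElectromagneticStructure.covJ (Ξ : ElectromagneticStructure d F S) (y : 𝓜)
    (s : Π y : 𝓜, S y) : TangentSpace (𝓡 d) y →L[ℝ] S y :=
  Ξ.D (fun y' ↦ Ξ.J y' (s y')) y - (Ξ.J y).comp (Ξ.D s y)

theorem ElectromagneticStructure.mdifferentiableAt_J (Ξ : ElectromagneticStructure d F S) {y : 𝓜}
    {s : Π y : 𝓜, S y}
    (hs : MDifferentiableAt (𝓡 d) ((𝓡 d).prod 𝓘(ℝ, F)) (fun y' ↦ TotalSpace.mk' F y' (s y')) y) :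
    MDifferentiableAt (𝓡 d) ((𝓡 d).prod 𝓘(ℝ, F))
      (fun y' ↦ TotalSpace.mk' F y' (Ξ.J y' (s y'))) y :=
  (Ξ.J_smooth.mdifferentiable (by simp) _).comp y hs

theorem ElectromagneticStructure.tensorial_covJ (Ξ : ElectromagneticStructure d F S) (y : 𝓜) :
    TensorialAt (𝓡 d) F (Ξ.covJ y) y where
  smul {h s} hh hs := by
    have e : (fun y' ↦ Ξ.J y' ((h • s) y')) = h • (fun y' ↦ Ξ.J y' (s y')) := by
      funext y'; simp
    have := Ξ.D.isCovariantDerivativeOnUniv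
    rw [covJ, covJ, e, this.leibniz hs hh, this.leibniz (Ξ.mdifferentiableAt_J hs) hh]
    ext v
    simp [smul_sub]
  add {s t} hs ht := by
    have e : (fun y' ↦ Ξ.J y' ((s + t) y'))
        = (fun y' ↦ Ξ.J y' (s y')) + (fun y' ↦ Ξ.J y' (t y')) := by
      funext y'; simp
    have := Ξ.D.isCovariantDerivativeOnUniv
    rw [covJ, covJ, covJ, e, this.add hs ht,
      this.add (Ξ.mdifferentiableAt_J hs) (Ξ.mdifferentiableAt_J ht)]
    ext v
    simp
    abel

/-- The fundamental form `Θ = D ∘ J - J ∘ D`, a one-form with values in `End(S)`: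
`fundamentalForm Ξ y v` is the endomorphism `Θ(v)` of `S y`. -/
def ElectromagneticStructure.fundamentalForm (Ξ : ElectromagneticStructure d F S) (y : 𝓜) :
    TangentSpace (𝓡 d) y →ₗ[ℝ] Module.End ℝ (S y) :=
  haveI : ContMDiffVectorBundle 1 F S (𝓡 d) := inferInstance
  LinearMap.mk₂ ℝ (fun (v : TangentSpace (𝓡 d) y) (s : S y) ↦
      TensorialAt.mkHom (Ξ.covJ y) y (Ξ.tensorial_covJ y) s v)
    (by simp) (by simp) (by simp) (by simp)

/-- The fundamental field `Ψ = (♯ ⊗ id)(Θ) ∈ T𝓜 ⊗ End(S)`. -/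
def fundamentalField (Sig : ScalarStructure d 𝓜) (Ξ : ElectromagneticStructure d F S) (y : 𝓜) :
    TensorProduct ℝ (TangentSpace (𝓡 d) y) (Module.End ℝ (S y)) :=
  LinearMap.rTensor (Module.End ℝ (S y))
    ((sharp Sig.metric.inner y).toLinearMap ∘ₗ
      (LinearMap.toContinuousLinearMap :
        (TangentSpace (𝓡 d) y →ₗ[ℝ] ℝ) ≃ₗ[ℝ] (TangentSpace (𝓡 d) y →L[ℝ] ℝ)).toLinearMap)
    ((dualTensorHomEquiv (R := ℝ) (M := TangentSpace (𝓡 d) y)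
      (N := Module.End ℝ (S y))).symm (Ξ.fundamentalForm y))

/-! ### Scalar-electromagnetic configurations and solutions -/

section Fields

variable {M : Type*} [TopologicalSpace M] [ChartedSpace (EuclideanSpace ℝ (Fin 4)) M]
  [IsManifold (𝓡 4) ∞ M]

variable (d F S M) in
/-- A pair `(φ, V)` of a smooth map `φ : M → 𝓜` and a smooth two-form `V` on `M` with
values in `φ^* S`. Smoothness of `V` is smoothness of `V(X, Y)` for all smooth vector fields. -/
structure FieldPair where
  φ : ContMDiffMap (𝓡 4) (𝓡 d) M 𝓜 ∞
  V (x : M) : TangentSpace (𝓡 4) x [⋀^Fin 2]→ₗ[ℝ] S (φ x)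
  smooth_V (X Y : Π x : M, TangentSpace (𝓡 4) x) : SmoothVectorField X → SmoothVectorField Y →
    ContMDiff (𝓡 4) ((𝓡 d).prod 𝓘(ℝ, F)) ∞ (fun x ↦ TotalSpace.mk' F (φ x) (V x ![X x, Y x]))

/-- The twisted Hodge operator `⋆ = *_g ⊗ J^φ` at `x`. -/
def twistedHodge (o : ManifoldOrientation M) (g : LorentzianMetric M)
    (Ξ : ElectromagneticStructure d F S) (φ : M → 𝓜) (x : M)
    (η : TangentSpace (𝓡 4) x [⋀^Fin 2]→ₗ[ℝ] S (φ x)) :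
    TangentSpace (𝓡 4) x [⋀^Fin 2]→ₗ[ℝ] S (φ x) :=
  hodgeStar o g x ((Ξ.J (φ x)).toLinearMap.compAlternatingMap η)

/-- The twisted exterior differential `d_{D^φ}` of an `S^φ`-valued two-form, evaluated on three
vector fields, where `D^φ` is the pulled-back connection. -/
def twistedExteriorDerivative (Δ : DualityStructure d F S) (φ : M → 𝓜)
    (V : Π x : M, TangentSpace (𝓡 4) x [⋀^Fin 2]→ₗ[ℝ] S (φ x))
    (X Y Z : Π x : M, TangentSpace (𝓡 4) x) (x : M) : S (φ x) :=
  haveI : ContMDiffVectorBundle 1 F S (𝓡 d) := inferInstance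
  pullbackCov F (fun s y v ↦ Δ.D s y v) φ (fun x' ↦ V x' ![Y x', Z x']) x (X x)
  - pullbackCov F (fun s y v ↦ Δ.D s y v) φ (fun x' ↦ V x' ![X x', Z x']) x (Y x)
  + pullbackCov F (fun s y v ↦ Δ.D s y v) φ (fun x' ↦ V x' ![X x', Y x']) x (Z x)
  - V x ![VectorField.mlieBracket (𝓡 4) X Y x, Z x]
  + V x ![VectorField.mlieBracket (𝓡 4) X Z x, Y x]
  - V x ![VectorField.mlieBracket (𝓡 4) Y Z x, X x]

/-- The set `Conf^g_𝒟(M)` of global scalar-electromagnetic configurations of type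
`𝒟 = (Sig, Ξ)`: the two-form `V` is positively polarized. -/
def Conf (o : ManifoldOrientation M) (g : LorentzianMetric M)
    (Ξ : ElectromagneticStructure d F S) : Set (FieldPair d F S M) :=
  {p | ∀ x, twistedHodge o g Ξ p.φ x (p.V x) = p.V x}

/-- The scalar equations `θ_Σ(g, φ) - ½ (* V, Ψ^φ V) = 0`. -/
def ScalarEquation (o : ManifoldOrientation M) (g : LorentzianMetric M) (Sig : ScalarStructure d 𝓜)
    (Ξ : ElectromagneticStructure d F S) (p : FieldPair d F S M) : Prop :=
  ∀ x, modifiedTension Sig g p.φ x - (1 / 2 : ℝ) •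
    extendedFormInner g x (Ξ.Q (p.φ x)) (hodgeStar o g x (p.V x))
      (fundamentalField Sig Ξ (p.φ x)) (p.V x) = 0

/-- The twisted electromagnetic equations `d_{D^φ} V = 0`. -/
def ElectromagneticEquation (Δ : DualityStructure d F S) (p : FieldPair d F S M) : Prop :=
  ∀ X Y Z : Π x : M, TangentSpace (𝓡 4) x,
    SmoothVectorField X → SmoothVectorField Y → SmoothVectorField Z →
    ∀ x, twistedExteriorDerivative Δ p.φ p.V X Y Z x = 0

/-- The set `Sol^g_𝒟(M)` of global scalar-electromagnetic solutions of type `𝒟 = (Sig, Ξ)`. -/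
def Sol (o : ManifoldOrientation M) (g : LorentzianMetric M) (Sig : ScalarStructure d 𝓜)
    (Ξ : ElectromagneticStructure d F S) : Set (FieldPair d F S M) :=
  {p | p ∈ Conf o g Ξ ∧ ScalarEquation o g Sig Ξ p ∧
    ElectromagneticEquation Ξ.toDualityStructure p}

/-- The duality action `f ⋄ (φ, V) = (f₀ ∘ φ, f̂^φ(V))`. -/
def UnbasedAut.act (f : UnbasedAut d F S) (p : FieldPair d F S M) : FieldPair d F S M where
  φ := ⟨fun x ↦ f.base (p.φ x), f.base.contMDiff.comp p.φ.contMDiff⟩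
  V x := (f.fiber (p.φ x)).toLinearMap.compAlternatingMap (p.V x)
  smooth_V X Y hX hY := by
    refine (f.total.contMDiff.comp (p.smooth_V X Y hX hY)).congr fun x ↦ ?_
    exact (f.total_apply _ _).symm

end Fields

end Duality

end ESM

end

/-!
The pulled-back connection `D^φ` is defined by expanding a section in one local frame of `S`, but
additivity and the Leibniz rule make any other expansion of the section give the same result.
Expanding `f σ` in the push-forward of the frame used for `σ` shows that every automorphism of the
bundle which preserves the connection also preserves its pull-backs.

This applies to a duality `f` and the flat connection `D`, and to the differential `df₀` and the
Levi-Civita connection of `𝓜`, which `df₀` preserves by the Koszul formula. As `f₀` also preserves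
the gradient of `Φ`, and `f` carries `(J, Q, Θ)` to the corresponding objects of the twisted
structure, each term in the equations for `f ⋄ (φ, V)` is the image of the corresponding term for
`(φ, V)` under the isomorphism `f` or `df₀` of fibers. So a pair solves the equations exactly when
its image does, and the action of `f` on pairs is inverted by that of `f⁻¹`.
-/

noncomputable section

namespace ESM

section CovariantDerivativeAlong

variable {𝕜 : Type*} [NontriviallyNormedField 𝕜]
  {E : Type*} [NormedAddCommGroup E] [NormedSpace 𝕜 E] {H : Type*} [TopologicalSpace H]
  {I : ModelWithCorners 𝕜 E H} {N : Type*} [TopologicalSpace N] [ChartedSpace H N]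
  {F : Type*} [NormedAddCommGroup F] [NormedSpace 𝕜 F]
  {S : N → Type*} [TopologicalSpace (TotalSpace F S)]
  [∀ y, AddCommGroup (S y)] [∀ y, Module 𝕜 (S y)] [∀ y, TopologicalSpace (S y)]
  [FiberBundle F S]

theorem mvfderiv_fun_sum {ι E' : Type*} [NormedAddCommGroup E'] [NormedSpace 𝕜 E'] {t : Finset ι}
    {c : ι → N → E'} {y : N} (hc : ∀ i ∈ t, MDifferentiableAt I 𝓘(𝕜, E') (c i) y) :
    mvfderiv I (fun y' ↦ ∑ i ∈ t, c i y') y = ∑ i ∈ t, mvfderiv I (c i) y := by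
  classical
  suffices MDifferentiableAt I 𝓘(𝕜, E') (fun y' ↦ ∑ i ∈ t, c i y') y ∧
      mvfderiv I (fun y' ↦ ∑ i ∈ t, c i y') y = ∑ i ∈ t, mvfderiv I (c i) y from this.2
  induction t using Finset.induction_on with
  | empty => exact ⟨by simpa using mdifferentiableAt_const, by simp [mvfderiv_const]⟩
  | insert i t hi ih =>
    obtain ⟨hci, hct⟩ := Finset.forall_mem_insert .. |>.1 hc
    obtain ⟨hdiff, hderiv⟩ := ih hct
    simp only [Finset.sum_insert hi, ← hderiv]
    exact ⟨hci.add hdiff, mvfderiv_fun_add hci hdiff⟩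

theorem mvfderiv_sum_mul_comp {E' : Type*} [NormedAddCommGroup E']
    [NormedSpace 𝕜 E'] {H' : Type*} [TopologicalSpace H'] {I' : ModelWithCorners 𝕜 E' H'}
    {M : Type*} [TopologicalSpace M] [ChartedSpace H' M] {ι : Type*} {t : Finset ι}
    {φ : M → N} {x : M} {c : ι → M → 𝕜} {a : ι → N → 𝕜} (hφ : MDifferentiableAt I' I φ x)
    (hc : ∀ i, MDifferentiableAt I' 𝓘(𝕜) (c i) x)
    (ha : ∀ i, MDifferentiableAt I 𝓘(𝕜) (a i) (φ x)) (v : TangentSpace I' x) :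
    mvfderiv I' (fun x' ↦ ∑ i ∈ t, c i x' * a i (φ x')) x v =
      ∑ i ∈ t, (mvfderiv I' (c i) x v * a i (φ x) +
        c i x * mvfderiv I (a i) (φ x) (mfderiv I' I φ x v)) := by
  have haφ (i) : MDifferentiableAt I' 𝓘(𝕜) (fun x' ↦ a i (φ x')) x := (ha i).comp x hφ
  have hmul (i) : MDifferentiableAt I' 𝓘(𝕜) (fun x' ↦ c i x' * a i (φ x')) x :=
    (hc i).mul (haφ i)
  rw [mvfderiv_fun_sum fun i _ ↦ hmul i, sum_apply]
  refine Finset.sum_congr rfl fun i _ ↦ ?_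
  have hchain : mvfderiv I' (fun x' ↦ a i (φ x')) x v =
      mvfderiv I (a i) (φ x) (mfderiv I' I φ x v) := mvfderiv_comp_apply x (ha i) hφ v
  rw [mvfderiv_fun_mul (hc i) (haφ i)]
  simp only [add_apply, smul_apply, smul_eq_mul, hchain]
  ring

section LocalFrameCoeff

variable [VectorBundle 𝕜 F S] [ContMDiffVectorBundle 1 F S I]
  {e : Trivialization F (TotalSpace.proj : TotalSpace F S → N)} [MemTrivializationAtlas e]
  {ι : Type*} (b : Basis ι 𝕜 F) {y : N}

variable (I) in
theorem localFrameCoeff_eq_repr (hy : y ∈ e.baseSet) (w : S y) (i : ι) :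
    e.localFrameCoeff I b i y w = b.repr (e (TotalSpace.mk' F y w)).2 i := by
  simpa using e.localFrameCoeff_eq_coeff (I := I) (b := b) (s := FiberBundle.extend F w) hy (i := i)

variable (I) in
theorem sum_localFrameCoeff_smul_localFrame [Fintype ι] (hy : y ∈ e.baseSet) (w : S y) :
    ∑ i, e.localFrameCoeff I b i y w • e.localFrame b i y = w := by
  simpa using
    (e.eq_sum_localFrameCoeff_smul (I := I) (b := b) (s := FiberBundle.extend F w) hy).symm

theorem mdifferentiableAt_localFrame (hy : y ∈ e.baseSet) (i : ι) :
    MDiffAt (T% (e.localFrame b i)) y :=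
  (contMDiffAt_localFrame_of_mem 1 e b i hy).mdifferentiableAt one_ne_zero

end LocalFrameCoeff

variable (F) in
/-- `L` is a covariant derivative of sections of `S` in the direction of one tangent vector `v`:
it is additive and satisfies the Leibniz rule. Fixing `v` makes the notion apply to operators
such as `leviCivita`, which are linear in `v` only at differentiable sections. -/
structure IsCovariantDerivativeAlong {y : N} (v : TangentSpace I y) (L : (Π y, S y) → S y) :
    Prop where
  add {s t : Π y, S y} : MDiffAt (T% s) y → MDiffAt (T% t) y → L (s + t) = L s + L t
  leibniz {h : N → 𝕜} {s : Π y, S y} : MDiffAt h y → MDiffAt (T% s) y →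
    L (h • s) = h y • L s + mvfderiv I h y v • s y

namespace IsCovariantDerivativeAlong

variable {y : N} {v : TangentSpace I y} {L : (Π y, S y) → S y}

theorem congr_of_eventuallyEq (hL : IsCovariantDerivativeAlong F v L) {s t : Π y, S y}
    (hs : MDiffAt (T% s) y) (ht : MDiffAt (T% t) y) (hst : ∀ᶠ y' in 𝓝 y, s y' = t y') :
    L s = L t := by
  classical
  -- The indicator of `{s = t}` is constant near `y`, so it can play the part of a bump function.
  let ψ (y' : N) : 𝕜 := if s y' = t y' then 1 else 0
  have hψy : ψ y = 1 := by simp [ψ, hst.self_of_nhds]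
  have hψst : ψ • s = ψ • t := by
    funext y'
    by_cases h : s y' = t y' <;> simp [ψ, h]
  have hψ : HasMFDerivAt I 𝓘(𝕜) ψ y 0 :=
    (hasMFDerivAt_const (1 : 𝕜) y).congr_of_eventuallyEq (hst.mono fun y' hy' ↦ by simp [ψ, hy'])
  have hψL {u : Π y, S y} (hu : MDiffAt (T% u) y) : L (ψ • u) = L u := by
    rw [hL.leibniz hψ.mdifferentiableAt hu, hψy, mvfderiv, hψ.mfderiv]
    simp
  rw [← hψL hs, ← hψL ht, hψst]

variable [VectorBundle 𝕜 F S]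

theorem map_zero (hL : IsCovariantDerivativeAlong F v L) : L 0 = 0 := by
  have h0 : MDiffAt (T% (0 : Π y, S y)) y := mdifferentiableAt_zeroSection 𝕜 S
  simpa using hL.add h0 h0

theorem map_sum_smul (hL : IsCovariantDerivativeAlong F v L) {ι : Type*} (t : Finset ι)
    {a : ι → N → 𝕜} {s : ι → Π y, S y} (ha : ∀ i, MDiffAt (a i) y)
    (hs : ∀ i, MDiffAt (T% (s i)) y) :
    L (fun y' ↦ ∑ i ∈ t, a i y' • s i y') =
      ∑ i ∈ t, (a i y • L (s i) + mvfderiv I (a i) y v • s i y) := by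
  classical
  induction t using Finset.induction_on with
  | empty =>
    simp only [Finset.sum_empty]
    exact hL.map_zero
  | insert i t hi ih =>
    have ht : MDiffAt (T% fun y' ↦ ∑ j ∈ t, a j y' • s j y') y :=
      .sum_section fun j _ ↦ (ha j).smul_section (hs j)
    rw [Finset.sum_insert hi, ← ih, ← hL.leibniz (ha i) (hs i),
      ← hL.add ((ha i).smul_section (hs i)) ht]
    congr 1
    funext y'
    simp only [Finset.sum_insert hi, Pi.add_apply, Pi.smul_apply']

theorem eq_sum_localFrame [CompleteSpace 𝕜] [FiniteDimensional 𝕜 F] [ContMDiffVectorBundle 1 F S I]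
    (hL : IsCovariantDerivativeAlong F v L) {s : Π y, S y} (hs : MDiffAt (T% s) y)
    {e : Trivialization F (TotalSpace.proj : TotalSpace F S → N)} [MemTrivializationAtlas e]
    {ι : Type*} [Fintype ι] (b : Basis ι 𝕜 F) (he : y ∈ e.baseSet) :
    L s = ∑ i, (e.localFrameCoeff I b i y (s y) • L (e.localFrame b i) +
      mvfderiv I (fun y' ↦ e.localFrameCoeff I b i y' (s y')) y v • e.localFrame b i y) := by
  have hcoeff (i) : MDiffAt (fun y' ↦ e.localFrameCoeff I b i y' (s y')) y :=
    mdifferentiableAt_localFrameCoeff b he hs i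
  have hframe (i) : MDiffAt (T% (e.localFrame b i)) y := mdifferentiableAt_localFrame b he i
  rw [← hL.map_sum_smul Finset.univ hcoeff hframe]
  exact hL.congr_of_eventuallyEq hs (.sum_section fun i _ ↦ (hcoeff i).smul_section (hframe i))
    (e.eventually_eq_localFrame_sum_coeff_smul b he)

end IsCovariantDerivativeAlong

end CovariantDerivativeAlong

section PullbackConnection

variable {m d : ℕ} {M : Type*} [TopologicalSpace M] [ChartedSpace (EuclideanSpace ℝ (Fin m)) M]
  {N : Type*} [TopologicalSpace N] [ChartedSpace (EuclideanSpace ℝ (Fin d)) N]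
  {F : Type*} [NormedAddCommGroup F] [NormedSpace ℝ F] [FiniteDimensional ℝ F]
  {S : N → Type*} [TopologicalSpace (TotalSpace F S)]
  [∀ y, AddCommGroup (S y)] [∀ y, Module ℝ (S y)] [∀ y, TopologicalSpace (S y)]
  [FiberBundle F S] [VectorBundle ℝ F S] [ContMDiffVectorBundle 1 F S (𝓡 d)]

theorem pullbackCov_eq_sum {cov : (Π y : N, S y) → Π y : N, TangentSpace (𝓡 d) y → S y}
    {φ : M → N} {x : M} {v : TangentSpace (𝓡 m) x}
    (hcov : IsCovariantDerivativeAlong F (mfderiv (𝓡 m) (𝓡 d) φ x v)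
      fun s ↦ cov s (φ x) (mfderiv (𝓡 m) (𝓡 d) φ x v))
    (hφ : MDifferentiableAt (𝓡 m) (𝓡 d) φ x) {ι : Type*} [Fintype ι] {s : ι → Π y : N, S y}
    (hs : ∀ i, MDifferentiableAt (𝓡 d) ((𝓡 d).prod 𝓘(ℝ, F)) (T% (s i)) (φ x))
    {c : ι → M → ℝ} (hc : ∀ i, MDifferentiableAt (𝓡 m) 𝓘(ℝ) (c i) x) {σ : Π x : M, S (φ x)}
    (hσ : ∀ᶠ x' in 𝓝 x, σ x' = ∑ i, c i x' • s i (φ x')) :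
    pullbackCov F cov φ σ x v = ∑ i, (mvfderiv (𝓡 m) (c i) x v • s i (φ x) +
      c i x • cov (s i) (φ x) (mfderiv (𝓡 m) (𝓡 d) φ x v)) := by
  let e := trivializationAt F S (φ x)
  let b := finBasis ℝ F
  have he : φ x ∈ e.baseSet := FiberBundle.mem_baseSet_trivializationAt F S (φ x)
  let a (j) (i : ι) (y : N) : ℝ := e.localFrameCoeff (𝓡 d) b j y (s i y)
  have ha (j) (i : ι) : MDifferentiableAt (𝓡 d) 𝓘(ℝ) (a j i) (φ x) :=
    mdifferentiableAt_localFrameCoeff b he (hs i) j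
  have hcoeff (j) : (fun x' ↦ e.localFrameCoeff (𝓡 d) b j (φ x') (σ x')) =ᶠ[𝓝 x]
      fun x' ↦ ∑ i, c i x' * a j i (φ x') := hσ.mono fun x' hx' ↦ by
    simp only [hx', map_sum, map_smul, smul_eq_mul, a]
  have hdcoeff (j) : mvfderiv (𝓡 m) (fun x' ↦ e.localFrameCoeff (𝓡 d) b j (φ x') (σ x')) x v =
      ∑ i, (mvfderiv (𝓡 m) (c i) x v * a j i (φ x) +
        c i x * mvfderiv (𝓡 d) (a j i) (φ x) (mfderiv (𝓡 m) (𝓡 d) φ x v)) := by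
    rw [mvfderiv, (hcoeff j).mfderiv_eq]
    exact mvfderiv_sum_mul_comp hφ hc (ha j) v
  have hframe (i) : s i (φ x) = ∑ j, a j i (φ x) • e.localFrame b j (φ x) :=
    (sum_localFrameCoeff_smul_localFrame (𝓡 d) b he _).symm
  have hcovframe (i) : cov (s i) (φ x) (mfderiv (𝓡 m) (𝓡 d) φ x v) =
      ∑ j, (a j i (φ x) • cov (e.localFrame b j) (φ x) (mfderiv (𝓡 m) (𝓡 d) φ x v) +
        mvfderiv (𝓡 d) (a j i) (φ x) (mfderiv (𝓡 m) (𝓡 d) φ x v) • e.localFrame b j (φ x)) :=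
    hcov.eq_sum_localFrame (hs i) b he
  change ∑ j, (mvfderiv (𝓡 m) (fun x' ↦ e.localFrameCoeff (𝓡 d) b j (φ x') (σ x')) x v •
      e.localFrame b j (φ x) + e.localFrameCoeff (𝓡 d) b j (φ x) (σ x) •
      cov (e.localFrame b j) (φ x) (mfderiv (𝓡 m) (𝓡 d) φ x v)) = _
  simp only [hdcoeff, (hcoeff _).self_of_nhds, hcovframe, hframe, Finset.sum_smul,
    Finset.smul_sum, ← Finset.sum_add_distrib]
  rw [Finset.sum_comm]
  refine Finset.sum_congr rfl fun i _ ↦ Finset.sum_congr rfl fun j _ ↦ ?_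
  module

theorem mdifferentiableAt_localFrameCoeff_comp {φ : M → N} {σ : Π x : M, S (φ x)} {x : M}
    (hσ : MDifferentiableAt (𝓡 m) ((𝓡 d).prod 𝓘(ℝ, F))
      (fun x' ↦ TotalSpace.mk' F (φ x') (σ x')) x) {ι : Type*} (b : Basis ι ℝ F) (i : ι) :
    MDifferentiableAt (𝓡 m) 𝓘(ℝ)
      (fun x' ↦ (trivializationAt F S (φ x)).localFrameCoeff (𝓡 d) b i (φ x') (σ x')) x := by
  obtain ⟨hφ, hfiber⟩ := (mdifferentiableAt_totalSpace _ _).1 hσ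
  have hnear : ∀ᶠ x' in 𝓝 x, φ x' ∈ (trivializationAt F S (φ x)).baseSet :=
    hφ.continuousAt.eventually ((trivializationAt F S (φ x)).open_baseSet.mem_nhds
      (FiberBundle.mem_baseSet_trivializationAt F S (φ x)))
  refine (((b.coord i).toContinuousLinearMap.differentiableAt.mdifferentiableAt).comp x
    hfiber).congr_of_eventuallyEq (hnear.mono fun x' hx' ↦ ?_)
  exact localFrameCoeff_eq_repr (𝓡 d) b hx' (σ x') i

end PullbackConnection

section UnbasedAut

variable {d : ℕ} {𝓜 : Type*} [TopologicalSpace 𝓜] [ChartedSpace (EuclideanSpace ℝ (Fin d)) 𝓜]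
  {F : Type*} [NormedAddCommGroup F] [NormedSpace ℝ F]
  {S : 𝓜 → Type*} [TopologicalSpace (TotalSpace F S)]
  [∀ y, AddCommGroup (S y)] [∀ y, Module ℝ (S y)] [∀ y, TopologicalSpace (S y)]
  [FiberBundle F S]

namespace UnbasedAut

variable (f : UnbasedAut d F S)

/-- The isomorphism `S y ≃ S z` between the fibers of `S` induced by `f`, when `f₀` maps `y` to
`z`. Keeping the equation `f₀ y = z` as an argument avoids casts between fibers. -/
def fiberOfEq {y z : 𝓜} (h : f.base y = z) : S y ≃L[ℝ] S z :=
  h ▸ f.fiber y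

theorem mk_fiberOfEq {y z : 𝓜} (h : f.base y = z) (s : S y) :
    TotalSpace.mk' F z (f.fiberOfEq h s) = f.total (TotalSpace.mk' F y s) := by
  subst h
  exact (f.total_apply y s).symm

/-- The inverse automorphism of the vector bundle. -/
def symm : UnbasedAut d F S where
  base := f.base.symm
  total := f.total.symm
  fiber y := (f.fiberOfEq (f.base.apply_symm_apply y)).symm
  total_apply y s := by
    refine f.total.injective ((f.total.apply_symm_apply _).trans ?_)
    refine Eq.trans ?_ (f.mk_fiberOfEq (f.base.apply_symm_apply y) _)
    rw [ContinuousLinearEquiv.apply_symm_apply]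

/-- The push-forward `f ∘ s ∘ f₀⁻¹` of a section `s`. -/
def push (s : Π y : 𝓜, S y) (y : 𝓜) : S y :=
  f.fiberOfEq (f.base.apply_symm_apply y) (s (f.base.symm y))

theorem mk_push (s : Π y : 𝓜, S y) (y : 𝓜) :
    TotalSpace.mk' F y (f.push s y) =
      f.total (TotalSpace.mk' F (f.base.symm y) (s (f.base.symm y))) :=
  f.mk_fiberOfEq _ _

theorem push_base (s : Π y : 𝓜, S y) (y : 𝓜) : f.push s (f.base y) = f.fiber y (s y) := by
  have h := f.mk_push s (f.base y)
  rw [f.base.symm_apply_apply] at h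
  exact TotalSpace.mk_inj.1 (h.trans (f.total_apply y (s y)))

theorem push_extend_base [VectorBundle ℝ F S] {y : 𝓜} (s : S y) :
    f.push (FiberBundle.extend F s) (f.base y) = f.fiber y s := by
  rw [f.push_base, FiberBundle.extend_apply_self]

theorem mdifferentiableAt_push {s : Π y : 𝓜, S y} {y : 𝓜}
    (hs : MDifferentiableAt (𝓡 d) ((𝓡 d).prod 𝓘(ℝ, F)) (T% s) y) :
    MDifferentiableAt (𝓡 d) ((𝓡 d).prod 𝓘(ℝ, F)) (T% (f.push s)) (f.base y) := by
  have hbase : MDifferentiableAt (𝓡 d) (𝓡 d) f.base.symm (f.base y) :=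
    f.base.symm.mdifferentiable (by simp) _
  rw [← f.base.symm_apply_apply y] at hs
  simp only [mk_push]
  exact (f.total.mdifferentiable (by simp) _).comp (f.base y) (hs.comp (f.base y) hbase)

/-- The automorphism `f` preserves the operator `cov`, which is in general only meaningful at
differentiable sections: `cov` of the push-forward of `s` is the push-forward of `cov s`. -/
def IsParallel (cov : (Π y : 𝓜, S y) → Π y : 𝓜, TangentSpace (𝓡 d) y → S y) : Prop :=
  ∀ (s : Π y : 𝓜, S y) (y : 𝓜) (v : TangentSpace (𝓡 d) y),
    MDifferentiableAt (𝓡 d) ((𝓡 d).prod 𝓘(ℝ, F)) (T% s) y →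
    cov (f.push s) (f.base y) (mfderiv (𝓡 d) (𝓡 d) f.base y v) = f.fiber y (cov s y v)

variable {m : ℕ} {M : Type*} [TopologicalSpace M] [ChartedSpace (EuclideanSpace ℝ (Fin m)) M]
  [FiniteDimensional ℝ F] [VectorBundle ℝ F S] [ContMDiffVectorBundle 1 F S (𝓡 d)]

variable {f} in
theorem IsParallel.pullbackCov_comp
    {cov : (Π y : 𝓜, S y) → Π y : 𝓜, TangentSpace (𝓡 d) y → S y} (hf : f.IsParallel cov)
    (hcov : ∀ (y : 𝓜) (v : TangentSpace (𝓡 d) y),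
      IsCovariantDerivativeAlong F v fun s ↦ cov s y v)
    {φ : M → 𝓜} {σ : Π x : M, S (φ x)} {x : M}
    (hσ : MDifferentiableAt (𝓡 m) ((𝓡 d).prod 𝓘(ℝ, F))
      (fun x' ↦ TotalSpace.mk' F (φ x') (σ x')) x) (v : TangentSpace (𝓡 m) x) :
    pullbackCov F cov (fun x' ↦ f.base (φ x')) (fun x' ↦ f.fiber (φ x') (σ x')) x v =
      f.fiber (φ x) (pullbackCov F cov φ σ x v) := by
  let e := trivializationAt F S (φ x)
  let b := finBasis ℝ F
  have he : φ x ∈ e.baseSet := FiberBundle.mem_baseSet_trivializationAt F S (φ x)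
  have hφ : MDifferentiableAt (𝓡 m) (𝓡 d) φ x := ((mdifferentiableAt_totalSpace _ _).1 hσ).1
  have hframe (i) := mdifferentiableAt_localFrame (I := 𝓡 d) b he i
  have hnear : ∀ᶠ x' in 𝓝 x, φ x' ∈ e.baseSet :=
    hφ.continuousAt.eventually (e.open_baseSet.mem_nhds he)
  have hexpand : ∀ᶠ x' in 𝓝 x, f.fiber (φ x') (σ x') =
      ∑ i, e.localFrameCoeff (𝓡 d) b i (φ x') (σ x') •
        f.push (e.localFrame b i) (f.base (φ x')) := hnear.mono fun x' hx' ↦ by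
    simp only [f.push_base, ← map_smul, ← map_sum]
    rw [sum_localFrameCoeff_smul_localFrame (𝓡 d) b hx']
  have hbase : MDifferentiableAt (𝓡 d) (𝓡 d) f.base (φ x) :=
    f.base.mdifferentiable (by simp) _
  have hchain : mfderiv (𝓡 m) (𝓡 d) (fun x' ↦ f.base (φ x')) x v =
      mfderiv (𝓡 d) (𝓡 d) f.base (φ x) (mfderiv (𝓡 m) (𝓡 d) φ x v) :=
    mfderiv_comp_apply x hbase hφ v
  have hcomp : MDifferentiableAt (𝓡 m) (𝓡 d) (fun x' ↦ f.base (φ x')) x := hbase.comp x hφ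
  rw [pullbackCov_eq_sum (hcov _ _) hcomp
    (fun i ↦ f.mdifferentiableAt_push (hframe i))
    (mdifferentiableAt_localFrameCoeff_comp hσ b) hexpand]
  simp only [hchain, f.push_base, hf _ _ _ (hframe _)]
  simp only [pullbackCov, map_sum, map_add, map_smul]
  rfl

end UnbasedAut

end UnbasedAut

section LeviCivita

variable {d : ℕ} {N : Type*} [TopologicalSpace N] [ChartedSpace (EuclideanSpace ℝ (Fin d)) N]

theorem tangentMap_symm_tangentMap (f : Diffeomorph (𝓡 d) (𝓡 d) N N ∞)
    (p : TangentBundle (𝓡 d) N) :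
    tangentMap (𝓡 d) (𝓡 d) f.symm (tangentMap (𝓡 d) (𝓡 d) f p) = p := by
  have hcomp : f.symm ∘ f = id := funext f.symm_apply_apply
  rw [← tangentMap_comp_at p (f.symm.mdifferentiable (by simp) _)
    (f.mdifferentiable (by simp) _), hcomp, tangentMap_id, id]

variable [IsManifold (𝓡 d) ∞ N]

/-- A vector field is differentiable at a point. -/
abbrev DifferentiableFieldAt (X : Π y : N, TangentSpace (𝓡 d) y) (y : N) : Prop :=
  MDifferentiableAt (𝓡 d) ((𝓡 d).prod 𝓘(ℝ, EuclideanSpace ℝ (Fin d)))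
    (fun y' ↦ TotalSpace.mk' (EuclideanSpace ℝ (Fin d)) y' (X y')) y

theorem differentiableFieldAt_extend {y : N} (v : TangentSpace (𝓡 d) y) :
    DifferentiableFieldAt (FiberBundle.extend (EuclideanSpace ℝ (Fin d)) v) y :=
  FiberBundle.mdifferentiableAt_extend ..

/-- The automorphism of the tangent bundle given by the differential of a diffeomorphism. -/
def tangentAut (f : Diffeomorph (𝓡 d) (𝓡 d) N N ∞) :
    UnbasedAut d (EuclideanSpace ℝ (Fin d)) (fun y : N ↦ TangentSpace (𝓡 d) y) where
  base := f
  total :=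
    { toFun := tangentMap (𝓡 d) (𝓡 d) f
      invFun := tangentMap (𝓡 d) (𝓡 d) f.symm
      left_inv := tangentMap_symm_tangentMap f
      right_inv := tangentMap_symm_tangentMap f.symm
      contMDiff_toFun := f.contMDiff.contMDiff_tangentMap le_rfl
      contMDiff_invFun := f.symm.contMDiff.contMDiff_tangentMap le_rfl }
  fiber y := f.mfderivToContinuousLinearEquiv (by simp) y
  total_apply _ _ := rfl

variable {f : Diffeomorph (𝓡 d) (𝓡 d) N N ∞}

theorem tangentAut_push_base (X : Π y : N, TangentSpace (𝓡 d) y) (y : N) :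
    (tangentAut f).push X (f y) = mfderiv (𝓡 d) (𝓡 d) f y (X y) :=
  (tangentAut f).push_base X y

theorem mpullback_tangentAut_push (X : Π y : N, TangentSpace (𝓡 d) y) :
    VectorField.mpullback (𝓡 d) (𝓡 d) f ((tangentAut f).push X) = X := by
  funext y
  rw [VectorField.mpullback_apply, tangentAut_push_base,
    ← f.mfderivToContinuousLinearEquiv_coe (by simp), ContinuousLinearMap.inverse_equiv]
  exact ((tangentAut f).fiber y).symm_apply_apply (X y)

theorem mlieBracket_tangentAut_push {X Y : Π y : N, TangentSpace (𝓡 d) y} {y : N}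
    (hX : DifferentiableFieldAt X y) (hY : DifferentiableFieldAt Y y) :
    VectorField.mlieBracket (𝓡 d) ((tangentAut f).push X) ((tangentAut f).push Y) (f y) =
      mfderiv (𝓡 d) (𝓡 d) f y (VectorField.mlieBracket (𝓡 d) X Y y) := by
  have hle : minSmoothness ℝ 2 ≤ ∞ := by
    rw [minSmoothness_of_isRCLikeNormedField]
    exact WithTop.coe_le_coe.2 le_top
  have : IsManifold (𝓡 d) (minSmoothness ℝ 2) N := .of_le hle
  have h := VectorField.mpullback_mlieBracket (n := ∞) ((tangentAut f).mdifferentiableAt_push hX)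
    ((tangentAut f).mdifferentiableAt_push hY) (x₀ := y) (f := f) f.contMDiffAt hle
  rw [mpullback_tangentAut_push, mpullback_tangentAut_push, VectorField.mpullback_apply,
    ← f.mfderivToContinuousLinearEquiv_coe (by simp), ContinuousLinearMap.inverse_equiv] at h
  rw [← h, ← f.mfderivToContinuousLinearEquiv_coe (by simp)]
  exact (((tangentAut f).fiber y).apply_symm_apply _).symm

/-- The field of bilinear forms `G` is a pseudo-Riemannian metric: symmetric, nondegenerate, and
differentiable, which is the regularity used by the Koszul formula. -/
structure IsPseudoRiemannian (G : MetricField d N) : Prop where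
  symm (y : N) (v w : TangentSpace (𝓡 d) y) : G y v w = G y w v
  nondegenerate (y : N) (v : TangentSpace (𝓡 d) y) : (∀ w, G y v w = 0) → v = 0
  mdifferentiable : MDifferentiable (𝓡 d) ((𝓡 d).prod
      𝓘(ℝ, EuclideanSpace ℝ (Fin d) →L[ℝ] EuclideanSpace ℝ (Fin d) →L[ℝ] ℝ))
    (fun y ↦ TotalSpace.mk' (EuclideanSpace ℝ (Fin d) →L[ℝ] EuclideanSpace ℝ (Fin d) →L[ℝ] ℝ)
      (E := fun y : N ↦ TangentSpace (𝓡 d) y →L[ℝ] TangentSpace (𝓡 d) y →L[ℝ] ℝ) y (G y))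

theorem isPseudoRiemannian_inner (g : ContMDiffRiemannianMetric (𝓡 d) ∞
    (EuclideanSpace ℝ (Fin d)) (fun y : N ↦ TangentSpace (𝓡 d) y)) :
    IsPseudoRiemannian g.inner where
  symm := g.symm
  nondegenerate y v hv := by
    by_contra h
    exact (g.pos y v h).ne' (hv v)
  mdifferentiable := g.contMDiff.mdifferentiable (by simp)

namespace IsPseudoRiemannian

variable {G : MetricField d N} (hG : IsPseudoRiemannian G)
include hG

theorem mdifferentiableAt_apply {X Y : Π y : N, TangentSpace (𝓡 d) y} {y : N}
    (hX : DifferentiableFieldAt X y) (hY : DifferentiableFieldAt Y y) :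
    MDifferentiableAt (𝓡 d) 𝓘(ℝ) (fun y ↦ G y (X y) (Y y)) y := by
  have h := (hG.mdifferentiable y).clm_bundle_apply₂
    (F₁ := EuclideanSpace ℝ (Fin d)) (F₂ := EuclideanSpace ℝ (Fin d)) hX hY
  exact ((mdifferentiableAt_totalSpace _ _).1 h).2

theorem isInvertible (y : N) : (G y).IsInvertible := by
  let e : (TangentSpace (𝓡 d) y →ₗ[ℝ] ℝ) ≃ₗ[ℝ] (TangentSpace (𝓡 d) y →L[ℝ] ℝ) :=
    LinearMap.toContinuousLinearMap
  have hinj : Function.Injective (G y).toLinearMap :=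
    (injective_iff_map_eq_zero _).2 fun v hv ↦ hG.nondegenerate y v fun w ↦ by
      simpa using DFunLike.congr_fun hv w
  have hdim : finrank ℝ (TangentSpace (𝓡 d) y) = finrank ℝ (TangentSpace (𝓡 d) y →L[ℝ] ℝ) :=
    (Subspace.dual_finrank_eq (K := ℝ)).symm.trans e.finrank_eq
  have : FiniteDimensional ℝ (TangentSpace (𝓡 d) y →L[ℝ] ℝ) := e.finiteDimensional
  exact ⟨(LinearMap.linearEquivOfInjective _ hinj hdim).toContinuousLinearEquiv, rfl⟩

theorem eq_sharp_iff (y : N) (α : TangentSpace (𝓡 d) y →L[ℝ] ℝ) (v : TangentSpace (𝓡 d) y) :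
    v = sharp G y α ↔ ∀ w, G y v w = α w := by
  obtain ⟨e, he⟩ := hG.isInvertible y
  have h : sharp G y α = e.symm α := by
    rw [sharp, ← he, ContinuousLinearMap.inverse_equiv]
    rfl
  rw [h, ContinuousLinearEquiv.eq_symm_apply, ContinuousLinearMap.ext_iff, ← he]
  rfl

theorem ext {y : N} {v v' : TangentSpace (𝓡 d) y} (h : ∀ w, G y v w = G y v' w) : v = v' :=
  ((hG.eq_sharp_iff y (G y v') v).2 h).trans ((hG.eq_sharp_iff y _ v').2 fun _ ↦ rfl).symm

theorem apply_sharp (y : N) (α : TangentSpace (𝓡 d) y →L[ℝ] ℝ) (w : TangentSpace (𝓡 d) y) :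
    G y (sharp G y α) w = α w :=
  (hG.eq_sharp_iff y α _).1 rfl w

theorem tensorial_koszul_third {X Y : Π y : N, TangentSpace (𝓡 d) y} {y : N}
    (hX : DifferentiableFieldAt X y) (hY : DifferentiableFieldAt Y y) :
    TensorialAt (𝓡 d) (EuclideanSpace ℝ (Fin d)) (fun Z ↦ koszul G X Y Z y) y where
  smul {h Z} hh hZ := by
    simp only [koszul, Pi.smul_apply', map_smul, smul_eq_mul, smul_apply,
      VectorField.mlieBracket_smul_right hh hZ, map_add, add_apply]
    rw [mvfderiv_fun_mul hh (hG.mdifferentiableAt_apply hY hZ),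
      mvfderiv_fun_mul hh (hG.mdifferentiableAt_apply hX hZ)]
    simp only [add_apply, smul_apply, smul_eq_mul]
    rw [hG.symm y (Z y) (X y), hG.symm y (Z y) (Y y)]
    ring
  add {Z W} hZ hW := by
    simp only [koszul, Pi.add_apply, map_add, add_apply,
      VectorField.mlieBracket_add_right hZ hW]
    rw [mvfderiv_fun_add (hG.mdifferentiableAt_apply hY hZ) (hG.mdifferentiableAt_apply hY hW),
      mvfderiv_fun_add (hG.mdifferentiableAt_apply hX hZ) (hG.mdifferentiableAt_apply hX hW)]
    simp only [add_apply]
    ring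

theorem tensorial_koszul_first {Y Z : Π y : N, TangentSpace (𝓡 d) y} {y : N}
    (hY : DifferentiableFieldAt Y y) (hZ : DifferentiableFieldAt Z y) :
    TensorialAt (𝓡 d) (EuclideanSpace ℝ (Fin d)) (fun X ↦ koszul G X Y Z y) y where
  smul {h X} hh hX := by
    simp only [koszul, Pi.smul_apply', map_smul, smul_eq_mul, smul_apply,
      VectorField.mlieBracket_smul_left hh hX, map_add, add_apply]
    rw [mvfderiv_fun_mul hh (hG.mdifferentiableAt_apply hX hZ),
      mvfderiv_fun_mul hh (hG.mdifferentiableAt_apply hX hY)]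
    simp only [add_apply, smul_apply, smul_eq_mul]
    ring
  add {X W} hX hW := by
    simp only [koszul, Pi.add_apply, map_add, add_apply,
      VectorField.mlieBracket_add_left hX hW]
    rw [mvfderiv_fun_add (hG.mdifferentiableAt_apply hX hZ) (hG.mdifferentiableAt_apply hW hZ),
      mvfderiv_fun_add (hG.mdifferentiableAt_apply hX hY) (hG.mdifferentiableAt_apply hW hY)]
    simp only [add_apply]
    ring

theorem koszul_add_second {X Y W Z : Π y : N, TangentSpace (𝓡 d) y} {y : N}
    (hX : DifferentiableFieldAt X y) (hY : DifferentiableFieldAt Y y)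
    (hW : DifferentiableFieldAt W y) (hZ : DifferentiableFieldAt Z y) :
    koszul G X (Y + W) Z y = koszul G X Y Z y + koszul G X W Z y := by
  simp only [koszul, Pi.add_apply, map_add, add_apply,
    VectorField.mlieBracket_add_left hY hW, VectorField.mlieBracket_add_right hY hW]
  rw [mvfderiv_fun_add (hG.mdifferentiableAt_apply hY hZ) (hG.mdifferentiableAt_apply hW hZ),
    mvfderiv_fun_add (hG.mdifferentiableAt_apply hX hY) (hG.mdifferentiableAt_apply hX hW)]
  simp only [add_apply]
  ring

theorem koszul_smul_second {h : N → ℝ} {X Y Z : Π y : N, TangentSpace (𝓡 d) y} {y : N}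
    (hh : MDifferentiableAt (𝓡 d) 𝓘(ℝ) h y)
    (hX : DifferentiableFieldAt X y) (hY : DifferentiableFieldAt Y y)
    (hZ : DifferentiableFieldAt Z y) :
    koszul G X (h • Y) Z y =
      h y * koszul G X Y Z y + 2 * (mvfderiv (𝓡 d) h y (X y) * G y (Y y) (Z y)) := by
  simp only [koszul, Pi.smul_apply', map_smul, smul_eq_mul, smul_apply,
    VectorField.mlieBracket_smul_left hh hY, VectorField.mlieBracket_smul_right hh hY, map_add,
    add_apply]
  rw [mvfderiv_fun_mul hh (hG.mdifferentiableAt_apply hY hZ),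
    mvfderiv_fun_mul hh (hG.mdifferentiableAt_apply hX hY)]
  simp only [add_apply, smul_apply, smul_eq_mul]
  rw [hG.symm y (Y y) (X y)]
  ring

theorem apply_leviCivita {X Y Z : Π y : N, TangentSpace (𝓡 d) y} {y : N}
    (hX : DifferentiableFieldAt X y) (hY : DifferentiableFieldAt Y y)
    (hZ : DifferentiableFieldAt Z y) :
    G y (leviCivita G Y y (X y)) (Z y) = (1 / 2 : ℝ) * koszul G X Y Z y := by
  let X' := FiberBundle.extend (EuclideanSpace ℝ (Fin d)) (X y)
  have hX' : DifferentiableFieldAt X' y := differentiableFieldAt_extend _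
  have hT := hG.tensorial_koszul_third hX' hY
  have hlin : (LinearMap.toContinuousLinearMap ((tangentBasis y).constr ℝ fun a ↦
      (1 / 2 : ℝ) * koszul G X' Y
        (FiberBundle.extend (EuclideanSpace ℝ (Fin d)) (tangentBasis y a)) y)) =
      (1 / 2 : ℝ) • TensorialAt.mkHom (fun Z ↦ koszul G X' Y Z y) y hT := by
    refine ContinuousLinearMap.coe_injective ((tangentBasis y).ext fun a ↦ ?_)
    simp only [LinearMap.coe_toContinuousLinearMap, Basis.constr_basis,
      ContinuousLinearMap.toLinearMap_smul, LinearMap.smul_apply, smul_eq_mul]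
    rfl
  rw [leviCivita, hG.apply_sharp]
  refine (congrArg (fun T : TangentSpace (𝓡 d) y →L[ℝ] ℝ ↦ T (Z y)) hlin).trans ?_
  simp only [smul_apply, smul_eq_mul]
  rw [TensorialAt.mkHom_apply hT hZ]
  congr 1
  exact (hG.tensorial_koszul_first hY hZ).pointwise hX' hX (by simp [X'])

theorem apply_leviCivita_extend {Y : Π y : N, TangentSpace (𝓡 d) y} {y : N}
    (v w : TangentSpace (𝓡 d) y) (hY : DifferentiableFieldAt Y y) :
    G y (leviCivita G Y y v) w =
      (1 / 2 : ℝ) * koszul G (FiberBundle.extend (EuclideanSpace ℝ (Fin d)) v) Y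
        (FiberBundle.extend (EuclideanSpace ℝ (Fin d)) w) y := by
  have h := hG.apply_leviCivita (differentiableFieldAt_extend v) hY
    (differentiableFieldAt_extend w)
  rwa [FiberBundle.extend_apply_self, FiberBundle.extend_apply_self] at h

theorem isCovariantDerivativeAlong_leviCivita {y : N} (v : TangentSpace (𝓡 d) y) :
    IsCovariantDerivativeAlong (EuclideanSpace ℝ (Fin d)) v fun s ↦ leviCivita G s y v where
  add {s t} hs ht := by
    refine hG.ext fun w ↦ ?_
    rw [map_add, add_apply, hG.apply_leviCivita_extend v w hs, hG.apply_leviCivita_extend v w ht,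
      hG.apply_leviCivita_extend v w (mdifferentiableAt_add_section hs ht),
      hG.koszul_add_second (differentiableFieldAt_extend _) hs ht
        (differentiableFieldAt_extend _), mul_add]
  leibniz {h s} hh hs := by
    refine hG.ext fun w ↦ ?_
    rw [map_add, add_apply, map_smul, map_smul, smul_apply, smul_apply,
      hG.apply_leviCivita_extend v w hs, hG.apply_leviCivita_extend v w (hh.smul_section hs),
      hG.koszul_smul_second hh (differentiableFieldAt_extend _) hs
        (differentiableFieldAt_extend _), FiberBundle.extend_apply_self,
      FiberBundle.extend_apply_self, smul_eq_mul, smul_eq_mul]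
    ring

end IsPseudoRiemannian

/-- The diffeomorphism `f` is an isometry of the metric `G`. -/
def IsMetricIsometry (G : MetricField d N) (f : Diffeomorph (𝓡 d) (𝓡 d) N N ∞) : Prop :=
  ∀ (y : N) (v w : TangentSpace (𝓡 d) y),
    G (f y) (mfderiv (𝓡 d) (𝓡 d) f y v) (mfderiv (𝓡 d) (𝓡 d) f y w) = G y v w

namespace IsMetricIsometry

variable {G : MetricField d N} (hf : IsMetricIsometry G f) (hG : IsPseudoRiemannian G)
include hf hG

theorem mvfderiv_push {X Y Z : Π y : N, TangentSpace (𝓡 d) y} {y : N}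
    (hX : DifferentiableFieldAt X y) (hY : DifferentiableFieldAt Y y) :
    mvfderiv (𝓡 d) (fun y ↦ G y ((tangentAut f).push X y) ((tangentAut f).push Y y)) (f y)
        (mfderiv (𝓡 d) (𝓡 d) f y (Z y)) =
      mvfderiv (𝓡 d) (fun y ↦ G y (X y) (Y y)) y (Z y) := by
  have hcomp : (fun y ↦ G y ((tangentAut f).push X y) ((tangentAut f).push Y y)) ∘ f =
      fun y ↦ G y (X y) (Y y) := funext fun y' ↦ by
    simp only [Function.comp_apply, tangentAut_push_base, hf y']
  rw [← hcomp]
  exact (mvfderiv_comp_apply y (hG.mdifferentiableAt_apply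
    ((tangentAut f).mdifferentiableAt_push hX) ((tangentAut f).mdifferentiableAt_push hY))
    (f.mdifferentiable (by simp) y) (Z y)).symm

theorem koszul_push {X Y Z : Π y : N, TangentSpace (𝓡 d) y} {y : N}
    (hX : DifferentiableFieldAt X y) (hY : DifferentiableFieldAt Y y)
    (hZ : DifferentiableFieldAt Z y) :
    koszul G ((tangentAut f).push X) ((tangentAut f).push Y) ((tangentAut f).push Z) (f y) =
      koszul G X Y Z y := by
  simp only [koszul, tangentAut_push_base, mlieBracket_tangentAut_push hX hY,
    mlieBracket_tangentAut_push hX hZ, mlieBracket_tangentAut_push hY hZ, hf y,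
    hf.mvfderiv_push hG hX hY, hf.mvfderiv_push hG hX hZ, hf.mvfderiv_push hG hY hZ]

theorem isParallel_leviCivita : (tangentAut f).IsParallel (leviCivita G) := by
  intro Y y v hY
  refine hG.ext fun w ↦ ?_
  obtain ⟨w, rfl⟩ := ((tangentAut f).fiber y).surjective w
  have hX := differentiableFieldAt_extend v
  have hZ := differentiableFieldAt_extend w
  have hkoszul := hG.apply_leviCivita ((tangentAut f).mdifferentiableAt_push hX)
    ((tangentAut f).mdifferentiableAt_push hY) ((tangentAut f).mdifferentiableAt_push hZ)
  rw [(tangentAut f).push_extend_base v, (tangentAut f).push_extend_base w] at hkoszul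
  exact hkoszul.trans ((congrArg _ (hf.koszul_push hG hX hY hZ)).trans
    ((hG.apply_leviCivita_extend v w hY).symm.trans (hf y _ w).symm))

theorem sharp_base (y : N) (α : TangentSpace (𝓡 d) (f y) →L[ℝ] ℝ) :
    sharp G (f y) α =
      mfderiv (𝓡 d) (𝓡 d) f y (sharp G y (α.comp (mfderiv (𝓡 d) (𝓡 d) f y))) := by
  refine ((hG.eq_sharp_iff _ _ _).2 fun w ↦ ?_).symm
  obtain ⟨w, rfl⟩ := ((tangentAut f).fiber y).surjective w
  exact (hf _ _ _).trans (hG.apply_sharp _ _ _)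

end IsMetricIsometry

end LeviCivita

theorem dualTensorHomEquiv_symm_eq_sum {R ι V W : Type*} [CommRing R] [Fintype ι]
    [AddCommGroup V] [Module R V] [Module.Finite R V] [Projective R V] [AddCommGroup W]
    [Module R W] (b : Basis ι R V) (A : V →ₗ[R] W) :
    (dualTensorHomEquiv (R := R) (M := V) (N := W)).symm A = ∑ i, b.coord i ⊗ₜ[R] A (b i) := by
  classical
  rw [LinearEquiv.symm_apply_eq]
  refine b.ext fun j ↦ ?_
  rw [map_sum, LinearMap.sum_apply]
  simp [dualTensorHomEquiv, Finsupp.single_apply]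

section FormAlgebra

variable {M : Type*} [TopologicalSpace M] [ChartedSpace (EuclideanSpace ℝ (Fin 4)) M]
  [IsManifold (𝓡 4) ∞ M] {W W' : Type*} [AddCommGroup W] [Module ℝ W] [AddCommGroup W']
  [Module ℝ W']

theorem hodgeStar_compAlternatingMap (o : ManifoldOrientation M) (g : LorentzianMetric M) (x : M)
    (L : W →ₗ[ℝ] W') (ρ : TangentSpace (𝓡 4) x [⋀^Fin 2]→ₗ[ℝ] W) :
    hodgeStar o g x (L.compAlternatingMap ρ) = L.compAlternatingMap (hodgeStar o g x ρ) := by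
  change _ = LinearMap.compAlternatingMapₗ ℝ L _
  simp only [hodgeStar, map_smul, map_sum]
  refine congrArg _ (Finset.sum_congr rfl fun i _ ↦ Finset.sum_congr rfl fun j _ ↦
    Finset.sum_congr rfl fun k _ ↦ Finset.sum_congr rfl fun l _ ↦ congrArg _ ?_)
  exact AlternatingMap.ext fun v ↦ (L.map_smul _ _).symm

theorem formInner_compAlternatingMap (g : LorentzianMetric M) (x : M) {Q : W →ₗ[ℝ] W →ₗ[ℝ] ℝ}
    {Q' : W' →ₗ[ℝ] W' →ₗ[ℝ] ℝ} {L : W →ₗ[ℝ] W'} (hL : ∀ s t, Q' (L s) (L t) = Q s t)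
    (α β : TangentSpace (𝓡 4) x [⋀^Fin 2]→ₗ[ℝ] W) :
    formInner g x Q' (L.compAlternatingMap α) (L.compAlternatingMap β) = formInner g x Q α β := by
  simp only [formInner, LinearMap.compAlternatingMap_apply, hL]

theorem metricTrace_map {d : ℕ} {N : Type*} [TopologicalSpace N]
    [ChartedSpace (EuclideanSpace ℝ (Fin d)) N] (G : MetricField d N) (x : N) (L : W →ₗ[ℝ] W')
    (B : TangentSpace (𝓡 d) x → TangentSpace (𝓡 d) x → W) :
    metricTrace G x (fun u v ↦ L (B u v)) = L (metricTrace G x B) := by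
  simp only [metricTrace, map_sum, map_smul]

end FormAlgebra

section Tension

variable {M : Type*} [TopologicalSpace M] [ChartedSpace (EuclideanSpace ℝ (Fin 4)) M]
  [IsManifold (𝓡 4) ∞ M]
  {d : ℕ} {𝓜 : Type*} [TopologicalSpace 𝓜] [ChartedSpace (EuclideanSpace ℝ (Fin d)) 𝓜]
  [IsManifold (𝓡 d) ∞ 𝓜] {f : Diffeomorph (𝓡 d) (𝓡 d) 𝓜 𝓜 ∞}

namespace IsMetricIsometry

variable {G : MetricField d 𝓜} (hf : IsMetricIsometry G f) (hG : IsPseudoRiemannian G)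
include hf hG

theorem secondFundamentalForm_comp (g : MetricField 4 M) {φ : M → 𝓜}
    (hφ : ContMDiff (𝓡 4) (𝓡 d) 2 φ) (x : M) (u v : TangentSpace (𝓡 4) x) :
    secondFundamentalForm g G (fun x ↦ f (φ x)) x u v =
      mfderiv (𝓡 d) (𝓡 d) f (φ x) (secondFundamentalForm g G φ x u v) := by
  let V : Π x' : M, TangentSpace (𝓡 4) x' := FiberBundle.extend (EuclideanSpace ℝ (Fin 4)) v
  have hchain (x' : M) (w : TangentSpace (𝓡 4) x') :
      mfderiv (𝓡 4) (𝓡 d) (fun x ↦ f (φ x)) x' w =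
        mfderiv (𝓡 d) (𝓡 d) f (φ x') (mfderiv (𝓡 4) (𝓡 d) φ x' w) :=
    mfderiv_comp_apply x' (f.mdifferentiable (by simp) _) (hφ.mdifferentiable (by simp) _) w
  have hdφV : MDifferentiableAt (𝓡 4) ((𝓡 d).prod 𝓘(ℝ, EuclideanSpace ℝ (Fin d)))
      (fun x' ↦ TotalSpace.mk' (EuclideanSpace ℝ (Fin d)) (E := fun y : 𝓜 ↦ TangentSpace (𝓡 d) y)
        (φ x') (mfderiv (𝓡 4) (𝓡 d) φ x' (V x'))) x :=
    ((hφ.contMDiff_tangentMap (m := 1) (by norm_num)).mdifferentiable (by simp) _).comp x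
      (differentiableFieldAt_extend v)
  have hparallel := (hf.isParallel_leviCivita hG).pullbackCov_comp
    (fun _ ↦ hG.isCovariantDerivativeAlong_leviCivita) hdφV u
  have hdfφV : (fun x' ↦ mfderiv (𝓡 4) (𝓡 d) (fun x ↦ f (φ x)) x' (V x')) =
      fun x' ↦ (tangentAut f).fiber (φ x') (mfderiv (𝓡 4) (𝓡 d) φ x' (V x')) :=
    funext fun x' ↦ hchain x' _
  unfold secondFundamentalForm
  rw [map_sub, hchain, hdfφV]
  exact congrArg (· - _) hparallel

theorem tensionField_comp (g : MetricField 4 M) {φ : M → 𝓜} (hφ : ContMDiff (𝓡 4) (𝓡 d) 2 φ)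
    (x : M) :
    tensionField g G (fun x ↦ f (φ x)) x =
      mfderiv (𝓡 d) (𝓡 d) f (φ x) (tensionField g G φ x) :=
  (congrArg (metricTrace g x) (funext₂ (hf.secondFundamentalForm_comp hG g hφ x))).trans
    (metricTrace_map g x (mfderiv (𝓡 d) (𝓡 d) f (φ x)).toLinearMap _)

theorem gradient_base {Φ : 𝓜 → ℝ} {y : 𝓜} (hΦ : MDifferentiableAt (𝓡 d) 𝓘(ℝ) Φ (f y))
    (hinv : ∀ y, Φ (f y) = Φ y) :
    gradient G Φ (f y) = mfderiv (𝓡 d) (𝓡 d) f y (gradient G Φ y) := by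
  have hderiv : (mvfderiv (𝓡 d) Φ (f y)).comp (mfderiv (𝓡 d) (𝓡 d) f y) =
      mvfderiv (𝓡 d) Φ y :=
    (mvfderiv_comp y hΦ (f.mdifferentiable (by simp) _)).symm.trans
      (congrArg (mvfderiv (𝓡 d) · y) (funext hinv))
  rw [gradient, hf.sharp_base hG, hderiv, gradient]

end IsMetricIsometry

theorem modifiedTension_comp {Sig : ScalarStructure d 𝓜} (g : LorentzianMetric M)
    (hf : IsMetricIsometry Sig.metric.inner f) (hpot : ∀ y, Sig.potential (f y) = Sig.potential y)
    {φ : M → 𝓜} (hφ : ContMDiff (𝓡 4) (𝓡 d) 2 φ) (x : M) :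
    modifiedTension Sig g (fun x ↦ f (φ x)) x =
      mfderiv (𝓡 d) (𝓡 d) f (φ x) (modifiedTension Sig g φ x) := by
  have hG := isPseudoRiemannian_inner Sig.metric
  unfold modifiedTension
  rw [hf.tensionField_comp hG _ hφ,
    hf.gradient_base hG (Sig.smooth_potential.mdifferentiable (by simp) _) hpot, map_sub]

end Tension

section Duality

variable {d : ℕ} {𝓜 : Type*} [TopologicalSpace 𝓜] [ChartedSpace (EuclideanSpace ℝ (Fin d)) 𝓜]
  [IsManifold (𝓡 d) ∞ 𝓜]
  {F : Type*} [NormedAddCommGroup F] [NormedSpace ℝ F]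
  {S : 𝓜 → Type*} [TopologicalSpace (TotalSpace F S)]
  [∀ y, AddCommGroup (S y)] [∀ y, Module ℝ (S y)] [∀ y, TopologicalSpace (S y)]
  [∀ y, IsTopologicalAddGroup (S y)] [∀ y, ContinuousSMul ℝ (S y)]
  [FiberBundle F S] [VectorBundle ℝ F S]

theorem DualityStructure.isCovariantDerivativeAlong (Δ : DualityStructure d F S) {y : 𝓜}
    (v : TangentSpace (𝓡 d) y) : IsCovariantDerivativeAlong F v fun s ↦ Δ.D s y v where
  add hs ht := by rw [Δ.D.isCovariantDerivativeOnUniv.add hs ht, add_apply]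
  leibniz hh hs := by rw [Δ.D.isCovariantDerivativeOnUniv.leibniz hs hh]; rfl

variable {Δ : DualityStructure d F S} {f : UnbasedAut d F S}

theorem IsDualitySymmetry.isParallel (hf : IsDualitySymmetry Δ f) :
    f.IsParallel fun s y v ↦ Δ.D s y v :=
  fun s y v hs ↦ hf.parallel s (f.push s) (f.push_base s) y v hs

variable [FiniteDimensional ℝ F] [ContMDiffVectorBundle ∞ F S (𝓡 d)]
  {M : Type*} [TopologicalSpace M] [ChartedSpace (EuclideanSpace ℝ (Fin 4)) M]
  [IsManifold (𝓡 4) ∞ M] {Ξ : ElectromagneticStructure d F S}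

theorem IsDualitySymmetry.twistedExteriorDerivative_act (hf : IsDualitySymmetry Δ f)
    (p : FieldPair d F S M) {X Y Z : Π x : M, TangentSpace (𝓡 4) x} (hX : SmoothVectorField X)
    (hY : SmoothVectorField Y) (hZ : SmoothVectorField Z) (x : M) :
    twistedExteriorDerivative Δ (f.act p).φ (f.act p).V X Y Z x =
      f.fiber (p.φ x) (twistedExteriorDerivative Δ p.φ p.V X Y Z x) := by
  have : ContMDiffVectorBundle 1 F S (𝓡 d) := inferInstance
  have pullbackCov_act {A B : Π x : M, TangentSpace (𝓡 4) x} (hA : SmoothVectorField A)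
      (hB : SmoothVectorField B) (v : TangentSpace (𝓡 4) x) :
      pullbackCov F (fun s y (v : TangentSpace (𝓡 d) y) ↦ Δ.D s y v) (f.act p).φ
          (fun x' ↦ (f.act p).V x' ![A x', B x']) x v =
        f.fiber (p.φ x) (pullbackCov F (fun s y (v : TangentSpace (𝓡 d) y) ↦ Δ.D s y v) p.φ
          (fun x' ↦ p.V x' ![A x', B x']) x v) :=
    hf.isParallel.pullbackCov_comp (fun _ ↦ Δ.isCovariantDerivativeAlong)
      ((p.smooth_V A B hA hB).mdifferentiable (by simp) x) v
  simp only [twistedExteriorDerivative, map_sub, map_add, pullbackCov_act hY hZ,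
    pullbackCov_act hX hZ, pullbackCov_act hX hY]
  rfl

theorem UnbasedAut.Ad_push (f : UnbasedAut d F S) (A : Π y : 𝓜, S y →L[ℝ] S y)
    (s : Π y : 𝓜, S y) :
    (fun y ↦ f.Ad A y (f.push s y)) = f.push fun y ↦ A y (s y) := by
  funext y
  obtain ⟨y, rfl⟩ := (show Function.Surjective f.base from f.base.surjective) y
  rw [f.push_base, f.push_base, f.Ad_base]

theorem IsDualitySymmetry.covJ_push (hf : IsDualitySymmetry Ξ.toDualityStructure f)
    {s : Π y : 𝓜, S y} {y : 𝓜} (hs : MDifferentiableAt (𝓡 d) ((𝓡 d).prod 𝓘(ℝ, F)) (T% s) y)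
    (v : TangentSpace (𝓡 d) y) :
    (Ξ.twist f hf.symplectic).covJ (f.base y) (f.push s) (mfderiv (𝓡 d) (𝓡 d) f.base y v) =
      f.fiber y (Ξ.covJ y s v) := by
  have hJs : (fun y ↦ (Ξ.twist f hf.symplectic).J y (f.push s y)) = f.push fun y ↦ Ξ.J y (s y) :=
    f.Ad_push Ξ.J s
  rw [ElectromagneticStructure.covJ, ElectromagneticStructure.covJ, hJs, sub_apply, sub_apply,
    map_sub]
  exact congrArg₂ (· - ·) (hf.isParallel _ y v (Ξ.mdifferentiableAt_J hs))
    ((congrArg _ (hf.isParallel s y v hs)).trans (f.Ad_base Ξ.J y (Ξ.D s y v)))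

theorem IsDualitySymmetry.fundamentalForm_twist (hf : IsDualitySymmetry Ξ.toDualityStructure f)
    (y : 𝓜) (v : TangentSpace (𝓡 d) y) (s : S y) :
    (Ξ.twist f hf.symplectic).fundamentalForm (f.base y) (mfderiv (𝓡 d) (𝓡 d) f.base y v)
      (f.fiber y s) = f.fiber y (Ξ.fundamentalForm y v s) := by
  have : ContMDiffVectorBundle 1 F S (𝓡 d) := inferInstance
  have hs := FiberBundle.mdifferentiableAt_extend (𝓡 d) F s
  have hpush := TensorialAt.mkHom_apply ((Ξ.twist f hf.symplectic).tensorial_covJ (f.base y))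
    (f.mdifferentiableAt_push hs)
  rw [f.push_extend_base] at hpush
  exact (congrArg (fun T ↦ T (mfderiv (𝓡 d) (𝓡 d) f.base y v)) hpush).trans (hf.covJ_push hs v)

theorem Q_twist_fiber
    (hf : ∀ (y : 𝓜) (s t : S y),
      Ξ.pairing (f.base y) (f.fiber y s) (f.fiber y t) = Ξ.pairing y s t)
    (y : 𝓜) (s t : S y) :
    (Ξ.twist f hf).Q (f.base y) (f.fiber y s) (f.fiber y t) = Ξ.Q y s t :=
  (congrArg (fun r ↦ Ξ.pairing (f.base y) r (f.fiber y t)) (f.Ad_base Ξ.J y s)).trans (hf y _ t)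

theorem extendedFormInner_fundamentalField (g : LorentzianMetric M) (Sig : ScalarStructure d 𝓜)
    (Ξ : ElectromagneticStructure d F S) (x : M) {y : 𝓜} (Q : S y →ₗ[ℝ] S y →ₗ[ℝ] ℝ)
    (α β : TangentSpace (𝓡 4) x [⋀^Fin 2]→ₗ[ℝ] S y) {ι : Type*} [Fintype ι]
    (b : Basis ι ℝ (TangentSpace (𝓡 d) y)) :
    extendedFormInner g x Q α (fundamentalField Sig Ξ y) β =
      ∑ i, formInner g x Q α ((Ξ.fundamentalForm y (b i)).compAlternatingMap β) •
        sharp Sig.metric.inner y (b.coord i).toContinuousLinearMap := by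
  rw [extendedFormInner, fundamentalField, dualTensorHomEquiv_symm_eq_sum b, map_sum, map_sum]
  rfl

theorem IsScalarElectromagneticDuality.extendedFormInner_twist {Sig : ScalarStructure d 𝓜}
    (hf : IsScalarElectromagneticDuality Sig Ξ.toDualityStructure f) (g : LorentzianMetric M)
    (x : M) {y : 𝓜} (α β : TangentSpace (𝓡 4) x [⋀^Fin 2]→ₗ[ℝ] S y) :
    extendedFormInner g x ((Ξ.twist f hf.symplectic).Q (f.base y))
        ((f.fiber y).toLinearMap.compAlternatingMap α)
        (fundamentalField Sig (Ξ.twist f hf.symplectic) (f.base y))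
        ((f.fiber y).toLinearMap.compAlternatingMap β) =
      mfderiv (𝓡 d) (𝓡 d) f.base y
        (extendedFormInner g x (Ξ.Q y) α (fundamentalField Sig Ξ y) β) := by
  let b := finBasis ℝ (TangentSpace (𝓡 d) y)
  let df : TangentSpace (𝓡 d) y ≃ₗ[ℝ] TangentSpace (𝓡 d) (f.base y) :=
    ((tangentAut f.base).fiber y).toLinearEquiv
  have hdf : IsMetricIsometry Sig.metric.inner f.base := hf.isometry
  rw [extendedFormInner_fundamentalField g Sig Ξ x _ α β b,
    extendedFormInner_fundamentalField g Sig _ x _ _ _ (b.map df), map_sum]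
  refine Finset.sum_congr rfl fun i _ ↦ ?_
  have hΘ : ((Ξ.twist f hf.symplectic).fundamentalForm (f.base y) (b.map df i)).compAlternatingMap
      ((f.fiber y).toLinearMap.compAlternatingMap β) =
      (f.fiber y).toLinearMap.compAlternatingMap
        ((Ξ.fundamentalForm y (b i)).compAlternatingMap β) :=
    AlternatingMap.ext fun v ↦ hf.fundamentalForm_twist y (b i) (β v)
  have hcoord : ((b.map df).coord i).toContinuousLinearMap.comp (mfderiv (𝓡 d) (𝓡 d) f.base y) =
      (b.coord i).toContinuousLinearMap := by
    ext v
    change (b.map df).coord i (df v) = b.coord i v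
    simp
  rw [hΘ, formInner_compAlternatingMap g x (Q_twist_fiber hf.symplectic y),
    hdf.sharp_base (isPseudoRiemannian_inner Sig.metric), hcoord, map_smul]

end Duality

section Action

variable {d : ℕ} {𝓜 : Type*} [TopologicalSpace 𝓜] [ChartedSpace (EuclideanSpace ℝ (Fin d)) 𝓜]
  {F : Type*} [NormedAddCommGroup F] [NormedSpace ℝ F]
  {S : 𝓜 → Type*} [TopologicalSpace (TotalSpace F S)]
  [∀ y, AddCommGroup (S y)] [∀ y, Module ℝ (S y)] [∀ y, TopologicalSpace (S y)]
  [FiberBundle F S]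
  {M : Type*} [TopologicalSpace M] [ChartedSpace (EuclideanSpace ℝ (Fin 4)) M]
  [IsManifold (𝓡 4) ∞ M]

theorem FieldPair.ext_totalSpace {p q : FieldPair d F S M} (hφ : ∀ x, p.φ x = q.φ x)
    (hV : ∀ x v, TotalSpace.mk' F (p.φ x) (p.V x v) = TotalSpace.mk' F (q.φ x) (q.V x v)) :
    p = q := by
  obtain ⟨φ, V, hVs⟩ := p
  obtain ⟨ψ, W, hWs⟩ := q
  obtain rfl : φ = ψ := ContMDiffMap.ext hφ
  obtain rfl : V = W := funext fun x ↦ AlternatingMap.ext fun v ↦ TotalSpace.mk_inj.1 (hV x v)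
  rfl

theorem UnbasedAut.mk_act (f : UnbasedAut d F S) (p : FieldPair d F S M) (x : M)
    (v : Fin 2 → TangentSpace (𝓡 4) x) :
    TotalSpace.mk' F ((f.act p).φ x) ((f.act p).V x v) =
      f.total (TotalSpace.mk' F (p.φ x) (p.V x v)) :=
  (f.total_apply _ _).symm

/-- The duality action of `f` as a permutation of the field pairs, with inverse the action of
`f⁻¹`. -/
def UnbasedAut.actEquiv (f : UnbasedAut d F S) : FieldPair d F S M ≃ FieldPair d F S M where
  toFun := f.act
  invFun := f.symm.act
  left_inv p := FieldPair.ext_totalSpace (fun x ↦ f.base.symm_apply_apply (p.φ x)) fun x v ↦ by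
    rw [mk_act, mk_act]
    exact f.total.symm_apply_apply _
  right_inv p := FieldPair.ext_totalSpace (fun x ↦ f.base.apply_symm_apply (p.φ x)) fun x v ↦ by
    rw [mk_act, mk_act]
    exact f.total.apply_symm_apply _

variable [IsManifold (𝓡 d) ∞ 𝓜] [FiniteDimensional ℝ F]
  [∀ y, IsTopologicalAddGroup (S y)] [∀ y, ContinuousSMul ℝ (S y)]
  [VectorBundle ℝ F S] [ContMDiffVectorBundle ∞ F S (𝓡 d)]
  {Sig : ScalarStructure d 𝓜} {Ξ : ElectromagneticStructure d F S} {f : UnbasedAut d F S}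

theorem twistedHodge_twist_act (o : ManifoldOrientation M) (g : LorentzianMetric M)
    (hf : ∀ (y : 𝓜) (s t : S y),
      Ξ.pairing (f.base y) (f.fiber y s) (f.fiber y t) = Ξ.pairing y s t)
    (p : FieldPair d F S M) (x : M) :
    twistedHodge o g (Ξ.twist f hf) (f.act p).φ x ((f.act p).V x) =
      (f.fiber (p.φ x)).toLinearMap.compAlternatingMap (twistedHodge o g Ξ p.φ x (p.V x)) := by
  rw [twistedHodge, twistedHodge, ← hodgeStar_compAlternatingMap]
  exact congrArg (hodgeStar o g x)
    (AlternatingMap.ext fun v ↦ f.Ad_base Ξ.J (p.φ x) (p.V x v))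

theorem act_mem_Conf_iff (o : ManifoldOrientation M) (g : LorentzianMetric M)
    (hf : ∀ (y : 𝓜) (s t : S y),
      Ξ.pairing (f.base y) (f.fiber y s) (f.fiber y t) = Ξ.pairing y s t)
    (p : FieldPair d F S M) : f.act p ∈ Conf o g (Ξ.twist f hf) ↔ p ∈ Conf o g Ξ := by
  refine forall_congr' fun x ↦ ?_
  rw [twistedHodge_twist_act]
  exact (f.fiber (p.φ x)).toLinearEquiv.alternatingMapCongrRight.injective.eq_iff

theorem IsDualitySymmetry.electromagneticEquation_act_iff {Δ : DualityStructure d F S}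
    (hf : IsDualitySymmetry Δ f) (p : FieldPair d F S M) :
    ElectromagneticEquation Δ (f.act p) ↔ ElectromagneticEquation Δ p := by
  refine forall₃_congr fun X Y Z ↦ forall₃_congr fun hX hY hZ ↦ forall_congr' fun x ↦ ?_
  rw [hf.twistedExteriorDerivative_act p hX hY hZ x]
  exact (f.fiber (p.φ x)).map_eq_zero_iff

theorem IsScalarElectromagneticDuality.scalarEquation_act_iff
    (hf : IsScalarElectromagneticDuality Sig Ξ.toDualityStructure f) (o : ManifoldOrientation M)
    (g : LorentzianMetric M) (p : FieldPair d F S M) :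
    ScalarEquation o g Sig (Ξ.twist f hf.symplectic) (f.act p) ↔ ScalarEquation o g Sig Ξ p := by
  refine forall_congr' fun x ↦ ?_
  have htension : modifiedTension Sig g (f.act p).φ x =
      (tangentAut f.base).fiber (p.φ x) (modifiedTension Sig g p.φ x) :=
    modifiedTension_comp g hf.isometry hf.potential (p.φ.contMDiff.of_le ENat.LEInfty.out) x
  have hinner : extendedFormInner g x ((Ξ.twist f hf.symplectic).Q ((f.act p).φ x))
      (hodgeStar o g x ((f.act p).V x))
      (fundamentalField Sig (Ξ.twist f hf.symplectic) ((f.act p).φ x)) ((f.act p).V x) =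
      (tangentAut f.base).fiber (p.φ x) (extendedFormInner g x (Ξ.Q (p.φ x))
        (hodgeStar o g x (p.V x)) (fundamentalField Sig Ξ (p.φ x)) (p.V x)) := by
    refine Eq.trans ?_ (hf.extendedFormInner_twist g x (hodgeStar o g x (p.V x)) (p.V x))
    rw [← hodgeStar_compAlternatingMap]
    rfl
  rw [htension, hinner]
  refine Iff.trans (Eq.congr_left ?_) ((tangentAut f.base).fiber (p.φ x)).map_eq_zero_iff
  rw [map_sub, map_smul]
  rfl

theorem IsScalarElectromagneticDuality.act_mem_Sol_iff
    (hf : IsScalarElectromagneticDuality Sig Ξ.toDualityStructure f) (o : ManifoldOrientation M)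
    (g : LorentzianMetric M) (p : FieldPair d F S M) :
    f.act p ∈ Sol o g Sig (Ξ.twist f hf.symplectic) ↔ p ∈ Sol o g Sig Ξ :=
  and_congr (act_mem_Conf_iff o g hf.symplectic p) (and_congr (hf.scalarEquation_act_iff o g p)
    (hf.toIsDualitySymmetry.electromagneticEquation_act_iff p))

end Action

end ESM

end

theorem mainTheorem1_general
    {M : Type*} [TopologicalSpace M] [ChartedSpace (EuclideanSpace ℝ (Fin 4)) M]
    [IsManifold (𝓡 4) ∞ M]
    (o : ESM.ManifoldOrientation M) (g : ESM.LorentzianMetric M)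
    {d : ℕ} {𝓜 : Type*} [TopologicalSpace 𝓜] [ChartedSpace (EuclideanSpace ℝ (Fin d)) 𝓜]
    [IsManifold (𝓡 d) ∞ 𝓜]
    {F : Type*} [NormedAddCommGroup F] [NormedSpace ℝ F] [FiniteDimensional ℝ F]
    {S : 𝓜 → Type*} [TopologicalSpace (TotalSpace F S)]
    [∀ y, AddCommGroup (S y)] [∀ y, Module ℝ (S y)] [∀ y, TopologicalSpace (S y)]
    [∀ y, IsTopologicalAddGroup (S y)] [∀ y, ContinuousSMul ℝ (S y)]
    [FiberBundle F S] [VectorBundle ℝ F S] [ContMDiffVectorBundle ∞ F S (𝓡 d)]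
    (Sig : ESM.ScalarStructure d 𝓜) (Ξ : ESM.ElectromagneticStructure d F S)
    (f : ESM.UnbasedAut d F S)
    (hf : ESM.IsScalarElectromagneticDuality Sig Ξ.toDualityStructure f) :
    Set.BijOn (f.act (M := M)) (ESM.Sol o g Sig Ξ) (ESM.Sol o g Sig (Ξ.twist f hf.symplectic)) :=
  f.actEquiv.bijOn (hf.act_mem_Sol_iff o g)

theorem mainTheorem1
    {M : Type*} [TopologicalSpace M] [T2Space M] [SecondCountableTopology M] [ConnectedSpace M]
    [ChartedSpace (EuclideanSpace ℝ (Fin 4)) M] [IsManifold (𝓡 4) ∞ M]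
    (o : ESM.ManifoldOrientation M) (g : ESM.LorentzianMetric M)
    {d : ℕ} {𝓜 : Type*} [TopologicalSpace 𝓜] [T2Space 𝓜] [SecondCountableTopology 𝓜]
    [ConnectedSpace 𝓜] [ChartedSpace (EuclideanSpace ℝ (Fin d)) 𝓜] [IsManifold (𝓡 d) ∞ 𝓜]
    {F : Type*} [NormedAddCommGroup F] [NormedSpace ℝ F] [FiniteDimensional ℝ F]
    {S : 𝓜 → Type*} [TopologicalSpace (TotalSpace F S)]
    [∀ y, AddCommGroup (S y)] [∀ y, Module ℝ (S y)] [∀ y, TopologicalSpace (S y)]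
    [∀ y, IsTopologicalAddGroup (S y)] [∀ y, ContinuousSMul ℝ (S y)]
    [FiberBundle F S] [VectorBundle ℝ F S] [ContMDiffVectorBundle ∞ F S (𝓡 d)]
    (Sig : ESM.ScalarStructure d 𝓜) (Ξ : ESM.ElectromagneticStructure d F S)
    (f : ESM.UnbasedAut d F S)
    (hf : ESM.IsScalarElectromagneticDuality Sig Ξ.toDualityStructure f) :
    Set.BijOn (f.act (M := M)) (ESM.Sol o g Sig Ξ) (ESM.Sol o g Sig (Ξ.twist f hf.symplectic)) :=
  mainTheorem1_general o g Sig Ξ f hf
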